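/- Let $\mathcal S^{d-1}$ be the unit sphere of $\mathbb R^d$, let $\mathsf s_d$ be the law of $\sqrt d\,\langle x,y\rangle$ for independent $x,y$ uniform on $\mathcal S^{d-1}$, and, for $d\ge 2$ and $k\ge 0$, let $q_k=q_k^{(d)}$ be the normalized Gegenbauer polynomials, i.e. the polynomials obtained from $1,t,t^2,\dots$ by the Gram--Schmidt procedure in $L^2(\mathsf s_d)$ (so $\deg q_k=k$ and $\mathbb E_{\xi\sim\mathsf s_d}\,q_i(\xi)q_j(\xi)=\delta_{ij}$). Let $N_0=1$ and $N_k=\frac{2k+d-2}{k}\binom{k+d-3}{k-1}$ for $k\ge1$ (the dimension of the space of spherical harmonics of degree $k$ in $d$ variables). For independent $x_1,\dots,x_n$ uniform on $\mathcal S^{d-1}$ let $A_k\in\mathbb R^{n\times n}$ be the matrix with entries $(A_k)_{ij}=\frac1{\sqrt n}\,q_k(\sqrt d\,\langle x_i,x_j\rangle)$ for $i\neq j$ and $(A_k)_{ii}=0$. Let $\|\cdot\|_{\mathrm{op}}$ be the spectral norm. For nonnegative random variables $X^{(d)},Y^{(d)}$ write $X\prec Y$ if for all $\varepsilon>0$ and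 $D>0$ one has $\mathbb P\big[X^{(d)}>d^{\varepsilon}Y^{(d)}\big]\le d^{-D}$ for all sufficiently large $d$. Let $k\ge0$ be an integer. (1) For all integers $d\ge2$, $n\ge1$ and $p\ge1$, the random variable $\operatorname{tr}(A_k^{2p})$ is integrable and $$\mathbb E\operatorname{tr}(A_k^{2p})\le n\,(2p)^{2p-2}\Big[\frac pn+\sum_{i=0}^{p-1}\Big(\frac n{N_k}\Big)^i\Big]\,\mathbb E_{\xi\sim\mathsf s_d}\,q_k^{2p}(\xi).$$ (2) Let $\alpha>0$ be a real number, let $\ell\ge1$ be an integer, and let $n=n(d)$ satisfy $n/d^\ell=\alpha+\mathcal O(d^{-1/2})$ as $d\to\infty$. Then $$\|A_k\|_{\mathrm{op}}\prec d^{\max\{\ell-k,0\}/2}.$$ In particular, if $k\ge\ell$, then $\|A_k\|_{\mathrm{op}}\prec1$. -/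

import Mathlib

open MeasureTheory ProbabilityTheory Filter Asymptotics

noncomputable section

/-- The uniform probability measure on the unit sphere of `ℝ^d` (for `1 ≤ d`), viewed as a measure
on the ambient Euclidean space: the normalized surface measure. -/
def unifSphere (d : ℕ) : Measure (EuclideanSpace ℝ (Fin d)) :=
  (((volume : Measure (EuclideanSpace ℝ (Fin d))).toSphere Set.univ)⁻¹ •
    (volume : Measure (EuclideanSpace ℝ (Fin d))).toSphere).map Subtype.val

/-- The law of `√d ⟨x, y⟩` for independent `x`, `y` uniform on the unit sphere of `ℝ^d`. -/
def sphereLaw (d : ℕ) : Measure ℝ :=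
  ((unifSphere d).prod (unifSphere d)).map (fun p => √(d : ℝ) * inner ℝ p.1 p.2)

/-- The `k`-th normalized Gegenbauer polynomial in dimension `d` (for `2 ≤ d`): the Gram-Schmidt
procedure in `L²(sphereLaw d)`, applied to the monomials `1, X, X², …`. -/
def gegenbauer (d : ℕ) (k : ℕ) : Polynomial ℝ :=
  let r : Polynomial ℝ := Polynomial.X ^ k -
    ∑ i : Fin k, Polynomial.C (∫ t, t ^ k * (gegenbauer d i).eval t ∂(sphereLaw d)) *
      gegenbauer d i
  Polynomial.C ((√(∫ t, (r.eval t) ^ 2 ∂(sphereLaw d)))⁻¹) * r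
termination_by k
decreasing_by all_goals exact i.isLt

/-- The dimension `N_k` of the space of spherical harmonics of degree `k` in `d` variables
(for `2 ≤ d`). -/
def harmonicDim (d k : ℕ) : ℝ :=
  if k = 0 then 1
  else (2 * (k : ℝ) + d - 2) / k * ((k + d - 3).choose (k - 1) : ℝ)

/-- The Gegenbauer component matrix `A_k` of the points `x_1, …, x_n`. -/
def gegenbauerMatrix (d k : ℕ) {n : ℕ} (x : Fin n → EuclideanSpace ℝ (Fin d)) :
    Matrix (Fin n) (Fin n) ℝ :=
  Matrix.of fun i j =>
    if i = j then 0
    else 1 / √(n : ℝ) * (gegenbauer d k).eval (√(d : ℝ) * inner ℝ (x i) (x j))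

/-- The operator (spectral) norm of a real square matrix, with respect to the Euclidean norm. -/
def opNorm {n : ℕ} (A : Matrix (Fin n) (Fin n) ℝ) : ℝ :=
  ‖Matrix.toEuclideanCLM (n := Fin n) (𝕜 := ℝ) A‖

/-- `x_1, …, x_n` are independent random vectors, each uniform on the unit sphere of `ℝ^d`. -/
structure IsIIDUnifSphere {Ω : Type*} [MeasurableSpace Ω] (P : Measure Ω) (d n : ℕ)
    (x : Fin n → Ω → EuclideanSpace ℝ (Fin d)) : Prop where
  measurable : ∀ i, Measurable (x i)
  law : ∀ i, P.map (x i) = unifSphere d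
  indep : iIndepFun x P

/-- Stochastic domination `X ≺ Y` of families of nonnegative random variables, where
`X d u` and `Y d u` live on the probability space `(Ω d, P d)`, uniformly in `u : U d`. -/
def StochDom {Ω : ℕ → Type*} [∀ d, MeasurableSpace (Ω d)] (P : ∀ d, Measure (Ω d))
    {U : ℕ → Type*} (X Y : ∀ d, U d → Ω d → ℝ) : Prop :=
  ∀ ε : ℝ, 0 < ε → ∀ D : ℝ, 0 < D → ∀ᶠ d : ℕ in atTop,
    ⨆ u : U d, P d {ω | X d u ω > (d : ℝ) ^ ε * Y d u ω} ≤ ENNReal.ofReal ((d : ℝ) ^ (-D))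

end

/-! The trace of `A_k ^ (2p)` is a sum over closed walks of length `2p` with distinct neighbours, so
everything rests on the expected weight of one walk. Write `E = q_k(√d)` and `M = 𝔼 q_k ^ (2p)`.

Two facts about the zonal kernel are decisive. It reproduces itself: integrating out a point `x` in
`q_k(√d⟨x,y⟩) q_k(√d⟨x,z⟩)` leaves `E⁻¹ q_k(√d⟨y,z⟩)` (`integral_gegenbauer_mul_gegenbauer`). And
`E² = N_k` (`gegenbauerEnd_sq`), proved by evaluating the three-term recurrence and its derivative
at `√d`, where the differential equation degenerates.

A vertex visited once can therefore be removed at the price `E⁻¹`, while a loop created on the way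
is worth `E`. The reduction stops at a single loop, or when there is no loop and each vertex occurs
at least twice; in the latter case AM-GM bounds the weight by `M`. The outcome,
`abs_integral_cycleProd_mul_le`, is that a walk of length `L` with `V` vertices has expected weight
at most `M N_k ^ (L/2 + 1 - V)`.

For the sum over walks, each is given mass `n ^ (-V)`; the total mass is at most `(2p-1)!`
(`sum_inv_pow_card_toFinset_le`), because prepending a letter multiplies the mass by at most the
length of the word. Relative to this mass, a walk contributes at most `n M (n/N_k) ^ (V-p-1)` if `V
> p + 1` and at most `n M` otherwise. This gives the trace bound, even without the term `p/n`.

For the operator norm, `N_k` is at least a constant times `d ^ k` and the moments of `q_k` are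
bounded uniformly in `d` (`exists_gegenbauer_moment_le`, by the three-term recurrence). Markov's
inequality for a high trace moment then suffices: the prefactor `n` of order `d ^ ℓ` is beaten by `d
^ (2pε)` once `p` is large. -/

open scoped Pointwise

/-! ### Rotation invariance of the uniform measure on the sphere. -/

section Sphere

/-- Expressing the mass by the volume of a cone reduces invariance under isometries to that of
Lebesgue measure. -/
lemma unifSphere_apply (d : ℕ) {A : Set (EuclideanSpace ℝ (Fin d))} (hA : MeasurableSet A) :
    unifSphere d A = ((volume : Measure (EuclideanSpace ℝ (Fin d))).toSphere Set.univ)⁻¹ *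
      (d * volume (Set.Ioo (0 : ℝ) 1 • (A ∩ Metric.sphere 0 1))) := by
  rw [unifSphere, Measure.map_apply measurable_subtype_coe hA, Measure.smul_apply, smul_eq_mul,
    Measure.toSphere_apply' _ (measurable_subtype_coe hA)]
  simp [Subtype.image_preimage_coe, Set.inter_comm]

lemma isProbabilityMeasure_unifSphere {d : ℕ} (hd : 1 ≤ d) :
    IsProbabilityMeasure (unifSphere d) := by
  have : NeZero d := ⟨by omega⟩
  have : Nontrivial (EuclideanSpace ℝ (Fin d)) := inferInstance
  constructor
  rw [unifSphere, Measure.map_apply measurable_subtype_coe MeasurableSet.univ, Set.preimage_univ,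
    Measure.smul_apply, smul_eq_mul]
  refine ENNReal.inv_mul_cancel ?_ (measure_ne_top _ _)
  rw [Measure.measure_univ_ne_zero]
  exact Measure.toSphere_ne_zero _

lemma ae_norm_eq_one_unifSphere (d : ℕ) : ∀ᵐ x ∂(unifSphere d), ‖x‖ = 1 := by
  rw [unifSphere, ae_map_iff measurable_subtype_coe.aemeasurable]
  · exact Eventually.of_forall fun x => by simp
  · exact measurableSet_eq_fun measurable_norm measurable_const

lemma unifSphere_map_isometry (d : ℕ)
    (T : EuclideanSpace ℝ (Fin d) ≃ₗᵢ[ℝ] EuclideanSpace ℝ (Fin d)) :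
    (unifSphere d).map T = unifSphere d := by
  ext A hA
  have hT : Measurable T := T.continuous.measurable
  rw [Measure.map_apply hT hA, unifSphere_apply d hA, unifSphere_apply d (hT hA)]
  congr 2
  rw [← T.measurePreserving.measure_preimage_equiv (f := T.toMeasurableEquiv)
    (Set.Ioo (0 : ℝ) 1 • (A ∩ Metric.sphere 0 1))]
  congr 1
  ext x
  simp only [Set.mem_smul, Set.mem_inter_iff, Set.mem_preimage, mem_sphere_zero_iff_norm]
  constructor
  · rintro ⟨r, hr, y, ⟨hy1, hy2⟩, rfl⟩
    exact ⟨r, hr, T y, ⟨hy1, by simpa using hy2⟩, by simp⟩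
  · rintro ⟨r, hr, y, ⟨hy1, hy2⟩, h⟩
    refine ⟨r, hr, T.symm y, ⟨by simpa using hy1, by simpa using hy2⟩, ?_⟩
    apply T.injective
    simpa using h

lemma integral_unifSphere_comp_isometry (d : ℕ)
    (T : EuclideanSpace ℝ (Fin d) ≃ₗᵢ[ℝ] EuclideanSpace ℝ (Fin d))
    (f : EuclideanSpace ℝ (Fin d) → ℝ) :
    ∫ x, f (T x) ∂(unifSphere d) = ∫ x, f x ∂(unifSphere d) := by
  conv_rhs => rw [← unifSphere_map_isometry d T]
  exact (T.toMeasurableEquiv.measurableEmbedding.integral_map f).symm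

/-- A continuous function is integrable on the sphere. -/
lemma integrable_unifSphere {d : ℕ} (hd : 1 ≤ d) {f : EuclideanSpace ℝ (Fin d) → ℝ}
    (hf : Continuous f) : Integrable f (unifSphere d) := by
  have := isProbabilityMeasure_unifSphere hd
  rw [← Measure.restrict_eq_self_of_ae_mem (μ := unifSphere d)
    (s := Metric.sphere (0 : EuclideanSpace ℝ (Fin d)) 1)]
  · exact hf.continuousOn.integrableOn_compact (isCompact_sphere _ _)
  · filter_upwards [ae_norm_eq_one_unifSphere d] with x hx using by simpa using hx

/-- The surface measure charges every nonempty open set, so almost everywhere equality of continuous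
functions is equality. -/
lemma eq_zero_of_integral_unifSphere_eq_zero {d : ℕ} (hd : 1 ≤ d)
    {f : EuclideanSpace ℝ (Fin d) → ℝ} (hf : Continuous f) (h0 : ∀ x, 0 ≤ f x)
    (h : ∫ x, f x ∂(unifSphere d) = 0) {x : EuclideanSpace ℝ (Fin d)} (hx : ‖x‖ = 1) :
    f x = 0 := by
  have : NeZero d := ⟨by omega⟩
  have : Nontrivial (EuclideanSpace ℝ (Fin d)) := inferInstance
  rw [integral_eq_zero_iff_of_nonneg h0 (integrable_unifSphere hd hf)] at h
  have h1 : ∀ᵐ x ∂(unifSphere d), f x = 0 := h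
  rw [unifSphere, ae_map_iff measurable_subtype_coe.aemeasurable
      (measurableSet_eq_fun hf.measurable measurable_const),
      Measure.ae_ennreal_smul_measure_iff (ENNReal.inv_ne_zero.2 (measure_ne_top _ _))] at h1
  have := Continuous.ae_eq_iff_eq (μ := (volume : Measure (EuclideanSpace ℝ (Fin d))).toSphere)
      (f := fun x : Metric.sphere (0 : EuclideanSpace ℝ (Fin d)) 1 => f x) (g := fun _ => 0)
      (hf.comp continuous_subtype_val) continuous_const
  exact congrFun (this.1 h1) ⟨x, by simpa using hx⟩

/-- Linear isometries act transitively on orthonormal pairs. -/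
lemma exists_isometry_of_orthonormal {d : ℕ} {ι : Type*} [Fintype ι]
    {v w : ι → EuclideanSpace ℝ (Fin d)} (hv : Orthonormal ℝ v)
    (hw : Orthonormal ℝ w) :
    ∃ T : EuclideanSpace ℝ (Fin d) ≃ₗᵢ[ℝ] EuclideanSpace ℝ (Fin d), ∀ i, T (v i) = w i := by
  classical
  have hcard : Fintype.card ι ≤ d := by
    simpa using hv.linearIndependent.fintype_card_le_finrank
  obtain ⟨e⟩ : Nonempty (ι ↪ Fin d) := Function.Embedding.nonempty_of_card_le (by simpa using hcard)
  have key : ∀ u : ι → EuclideanSpace ℝ (Fin d), Orthonormal ℝ u →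
      ∃ b : OrthonormalBasis (Fin d) ℝ (EuclideanSpace ℝ (Fin d)), ∀ i, b (e i) = u i := by
    intro u hu
    -- The zeros off the range of `e` are placeholders: only the family on the range is orthonormal
    -- and gets completed to a basis.
    let v' : Fin d → EuclideanSpace ℝ (Fin d) := Function.extend e u 0
    have hv' : Orthonormal ℝ ((Set.range e).domRestrict v') := by
      have : (Set.range e).domRestrict v' = u ∘ (Equiv.ofInjective e e.injective).symm := by
        funext ⟨x, i, hi⟩
        subst hi
        have : (Equiv.ofInjective e e.injective).symm ⟨e i, i, rfl⟩ = i := by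
          rw [Equiv.symm_apply_eq]; rfl
        simp only [Function.comp, this]
        exact e.injective.extend_apply _ _ _
      rw [this]
      exact hu.comp _ (Equiv.injective _)
    obtain ⟨b, hb⟩ := hv'.exists_orthonormalBasis_extension_of_card_eq (by simp)
    exact ⟨b, fun i => by rw [hb _ ⟨i, rfl⟩]; exact e.injective.extend_apply _ _ _⟩
  obtain ⟨b, hb⟩ := key v hv
  obtain ⟨c, hc⟩ := key w hw
  exact ⟨b.equiv c (Equiv.refl _), fun i => by rw [← hb, ← hc]; simp⟩

end Sphere

/-! ### The law of one coordinate: its moments and its integration by parts. -/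

section SphereLaw

lemma exists_unit_vector {d : ℕ} (hd : 1 ≤ d) : ∃ y : EuclideanSpace ℝ (Fin d), ‖y‖ = 1 :=
  ⟨EuclideanSpace.single ⟨0, hd⟩ 1, by simp⟩

lemma exists_isometry_of_norm_eq_one {d : ℕ} {y z : EuclideanSpace ℝ (Fin d)}
    (hy : ‖y‖ = 1) (hz : ‖z‖ = 1) :
    ∃ T : EuclideanSpace ℝ (Fin d) ≃ₗᵢ[ℝ] EuclideanSpace ℝ (Fin d), T y = z := by
  have h (u : EuclideanSpace ℝ (Fin d)) (hu : ‖u‖ = 1) :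
      Orthonormal ℝ (fun _ : Unit => u) :=
    ⟨fun _ => hu, fun i j hij => (hij (Subsingleton.elim i j)).elim⟩
  obtain ⟨T, hT⟩ := exists_isometry_of_orthonormal (h y hy) (h z hz)
  exact ⟨T, hT ()⟩

lemma continuous_zonal {d : ℕ} (y : EuclideanSpace ℝ (Fin d)) :
    Continuous fun x : EuclideanSpace ℝ (Fin d) => √(d : ℝ) * inner ℝ x y := by fun_prop

lemma unifSphere_map_zonal_eq {d : ℕ} {y z : EuclideanSpace ℝ (Fin d)}
    (hy : ‖y‖ = 1) (hz : ‖z‖ = 1) :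
    (unifSphere d).map (fun x => √(d : ℝ) * inner ℝ x y) =
      (unifSphere d).map (fun x => √(d : ℝ) * inner ℝ x z) := by
  obtain ⟨T, rfl⟩ := exists_isometry_of_norm_eq_one hy hz
  conv_rhs => rw [← unifSphere_map_isometry d T]
  rw [Measure.map_map (continuous_zonal _).measurable T.continuous.measurable]
  congr 1
  funext x
  simp

/-- By Fubini, condition on the second point: the conditional law is the same for all unit vectors.
From here on one point may be frozen. -/
lemma unifSphere_map_zonal {d : ℕ} (hd : 1 ≤ d) {y : EuclideanSpace ℝ (Fin d)}
    (hy : ‖y‖ = 1) :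
    (unifSphere d).map (fun x => √(d : ℝ) * inner ℝ x y) = sphereLaw d := by
  have := isProbabilityMeasure_unifSphere hd
  ext A hA
  have hm : Measurable fun p : EuclideanSpace ℝ (Fin d) × EuclideanSpace ℝ (Fin d) =>
    √(d : ℝ) * inner ℝ p.1 p.2 := by fun_prop
  rw [sphereLaw, Measure.map_apply hm hA, Measure.prod_apply_symm (hm hA)]
  have h : ∀ᵐ z ∂(unifSphere d), unifSphere d ((fun x => (x, z)) ⁻¹'
      ((fun p : EuclideanSpace ℝ (Fin d) × EuclideanSpace ℝ (Fin d) =>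
        √(d : ℝ) * inner ℝ p.1 p.2) ⁻¹' A)) =
      (unifSphere d).map (fun x => √(d : ℝ) * inner ℝ x y) A := by
    filter_upwards [ae_norm_eq_one_unifSphere d] with z hz
    rw [unifSphere_map_zonal_eq hy hz, Measure.map_apply (continuous_zonal z).measurable hA]
    rfl
  rw [lintegral_congr_ae h]
  simp

lemma integral_sphereLaw {d : ℕ} (hd : 1 ≤ d) {y : EuclideanSpace ℝ (Fin d)} (hy : ‖y‖ = 1)
    {f : ℝ → ℝ} (hf : Continuous f) :
    ∫ t, f t ∂(sphereLaw d) = ∫ x, f (√(d : ℝ) * inner ℝ x y) ∂(unifSphere d) := by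
  rw [← unifSphere_map_zonal hd hy,
    integral_map (continuous_zonal y).measurable.aemeasurable hf.aestronglyMeasurable]

lemma integrable_sphereLaw {d : ℕ} (hd : 1 ≤ d) {f : ℝ → ℝ} (hf : Continuous f) :
    Integrable f (sphereLaw d) := by
  obtain ⟨y, hy⟩ := exists_unit_vector hd
  rw [← unifSphere_map_zonal hd hy, integrable_map_measure hf.aestronglyMeasurable
    (continuous_zonal y).measurable.aemeasurable]
  exact integrable_unifSphere hd (hf.comp (continuous_zonal y))

lemma isProbabilityMeasure_sphereLaw {d : ℕ} (hd : 1 ≤ d) :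
    IsProbabilityMeasure (sphereLaw d) := by
  have := isProbabilityMeasure_unifSphere hd
  obtain ⟨y, hy⟩ := exists_unit_vector hd
  rw [← unifSphere_map_zonal hd hy]
  exact Measure.isProbabilityMeasure_map (continuous_zonal y).measurable.aemeasurable

/-- Expectation of a polynomial under `sphereLaw d`. -/
noncomputable def sphereExp (d : ℕ) (hd : 1 ≤ d) : Polynomial ℝ →ₗ[ℝ] ℝ where
  toFun p := ∫ t, p.eval t ∂(sphereLaw d)
  map_add' p q := by
    simp only [Polynomial.eval_add]
    exact integral_add (integrable_sphereLaw hd p.continuous) (integrable_sphereLaw hd q.continuous)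
  map_smul' c p := by
    simp only [Polynomial.eval_smul, smul_eq_mul, RingHom.id_apply]
    exact integral_const_mul _ _

variable {d : ℕ} (hd : 1 ≤ d)

lemma sphereExp_apply (p : Polynomial ℝ) :
    sphereExp d hd p = ∫ t, p.eval t ∂(sphereLaw d) := rfl

lemma sphereExp_eq_integral_unifSphere {y : EuclideanSpace ℝ (Fin d)} (hy : ‖y‖ = 1)
    (p : Polynomial ℝ) :
    sphereExp d hd p = ∫ x, p.eval (√(d : ℝ) * inner ℝ x y) ∂(unifSphere d) :=
  integral_sphereLaw hd hy p.continuous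

lemma sphereExp_one : sphereExp d hd 1 = 1 := by
  have := isProbabilityMeasure_sphereLaw hd
  simp [sphereExp_apply]

lemma sphereExp_sq_nonneg (p : Polynomial ℝ) : 0 ≤ sphereExp d hd (p ^ 2) := by
  rw [sphereExp_apply]
  exact integral_nonneg fun t => by simpa using sq_nonneg _

lemma sphereExp_comp_neg (p : Polynomial ℝ) :
    sphereExp d hd (p.comp (-Polynomial.X)) = sphereExp d hd p := by
  obtain ⟨y, hy⟩ := exists_unit_vector hd
  rw [sphereExp_eq_integral_unifSphere hd hy,
    sphereExp_eq_integral_unifSphere hd (y := -y) (by simpa using hy)]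
  simp

/-- For `2 ≤ d` every inner product in `[-1, 1]` with a given unit vector is attained. -/
lemma exists_orthonormal_pair (hd : 2 ≤ d) :
    ∃ y u : EuclideanSpace ℝ (Fin d), ‖y‖ = 1 ∧ ‖u‖ = 1 ∧ inner ℝ y u = 0 :=
  ⟨EuclideanSpace.single ⟨0, by omega⟩ 1, EuclideanSpace.single ⟨1, by omega⟩ 1, by simp, by simp,
    by simp [EuclideanSpace.inner_single_left]⟩

lemma norm_add_smul_of_orthonormal {y u : EuclideanSpace ℝ (Fin d)} (hy : ‖y‖ = 1) (hu : ‖u‖ = 1)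
    (hyu : inner ℝ y u = (0 : ℝ)) (a b : ℝ) : ‖a • y + b • u‖ ^ 2 = a ^ 2 + b ^ 2 := by
  rw [norm_add_sq_real]
  simp [norm_smul, hy, hu, inner_smul_left, inner_smul_right, hyu]

/-- Nondegeneracy of the inner product behind Gram-Schmidt: for `d ≥ 2` a coordinate takes
infinitely many values, at all of which `p` must vanish. -/
lemma eq_zero_of_sphereExp_sq_eq_zero (hd : 2 ≤ d) {p : Polynomial ℝ}
    (h : sphereExp d (one_le_two.trans hd) (p ^ 2) = 0) : p = 0 := by
  obtain ⟨y, u, hy, hu, hyu⟩ := exists_orthonormal_pair hd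
  rw [sphereExp_eq_integral_unifSphere _ hy] at h
  have h0 := fun x hx => eq_zero_of_integral_unifSphere_eq_zero (one_le_two.trans hd)
    (f := fun x => (p ^ 2).eval (√(d : ℝ) * inner ℝ x y))
    ((p ^ 2).continuous.comp (continuous_zonal y))
    (fun x => by simpa using sq_nonneg _) h (x := x) hx
  refine Polynomial.eq_zero_of_infinite_isRoot p
    (((Set.Icc_infinite (show (0 : ℝ) < 1 by norm_num)).image (f := fun c => √(d : ℝ) * c)
      (fun a _ b _ hab => ?_)).mono ?_)
  · have : (0 : ℝ) < √(d : ℝ) := Real.sqrt_pos.2 (by positivity)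
    exact mul_left_cancel₀ this.ne' hab
  · rintro _ ⟨c, ⟨hc0, hc1⟩, rfl⟩
    have hc2 : 0 ≤ 1 - c ^ 2 := by nlinarith
    have hn : ‖c • y + √(1 - c ^ 2) • u‖ = 1 := by
      rw [← sq_eq_sq₀ (norm_nonneg _) zero_le_one, norm_add_smul_of_orthonormal hy hu hyu,
        Real.sq_sqrt hc2]
      ring
    have := h0 _ hn
    have hin : inner ℝ (c • y + √(1 - c ^ 2) • u) y = c := by
      simp [inner_add_left, inner_smul_left, hy, real_inner_comm, hyu]
    simpa [hin] using this

lemma integral_pow_inner_add_smul {y u : EuclideanSpace ℝ (Fin d)} (hy : ‖y‖ = 1)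
    (hu : ‖u‖ = 1) (hyu : inner ℝ y u = (0 : ℝ)) (r : ℕ) (s : ℝ) :
    ∫ x, (inner ℝ x (y + s • u)) ^ (2 * r) ∂(unifSphere d) =
      (1 + s ^ 2) ^ r * ∫ x, (inner ℝ x y) ^ (2 * r) ∂(unifSphere d) := by
  have hn : ‖y + s • u‖ ^ 2 = 1 + s ^ 2 := by
    simpa using norm_add_smul_of_orthonormal hy hu hyu 1 s
  have hne : ‖y + s • u‖ ≠ 0 := by
    intro h
    rw [h] at hn
    nlinarith [sq_nonneg s]
  have hw : ‖(‖y + s • u‖)⁻¹ • (y + s • u)‖ = 1 := by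
    rw [norm_smul, norm_inv, norm_norm, inv_mul_cancel₀ hne]
  obtain ⟨T, hT⟩ := exists_isometry_of_norm_eq_one hy hw
  rw [← integral_unifSphere_comp_isometry d T, ← integral_const_mul]
  congr 1
  funext x
  have h : y + s • u = ‖y + s • u‖ • T y := by
    rw [hT, smul_smul, mul_inv_cancel₀ hne, one_smul]
  rw [h, inner_smul_right, T.inner_map_map, mul_pow, pow_mul, hn]

/-- Moments of a pair of orthonormal coordinates on the sphere. -/
lemma integral_pow_mul_sq (hd : 1 ≤ d) {y u : EuclideanSpace ℝ (Fin d)} (hy : ‖y‖ = 1)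
    (hu : ‖u‖ = 1) (hyu : inner ℝ y u = (0 : ℝ)) (r : ℕ) :
    (2 * r + 1) * ∫ x, (inner ℝ x y) ^ (2 * r) * (inner ℝ x u) ^ 2 ∂(unifSphere d) =
      ∫ x, (inner ℝ x y) ^ (2 * r + 2) ∂(unifSphere d) := by
  set M := ∫ x, (inner ℝ x y : ℝ) ^ (2 * (r + 1)) ∂(unifSphere d) with hM
  let c : ℕ → ℝ := fun i => ((2 * (r + 1)).choose i : ℝ) *
    ∫ x, (inner ℝ x u : ℝ) ^ i * (inner ℝ x y) ^ (2 * (r + 1) - i) ∂(unifSphere d)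
  -- By invariance the moment of order `2r + 2` in direction `y + s u` is `(1 + s²) ^ (r+1) M`. Both
  -- sides are polynomials in `s`; the claim is the comparison of the coefficients of `s²`.
  have hpoly : ∑ i ∈ Finset.range (2 * (r + 1) + 1), Polynomial.C (c i) * Polynomial.X ^ i =
      Polynomial.C M * Polynomial.expand ℝ 2 ((1 + Polynomial.X) ^ (r + 1)) := by
    refine Polynomial.funext fun s => ?_
    rw [Polynomial.eval_finsetSum, Polynomial.eval_mul, Polynomial.expand_eval]
    simp only [Polynomial.eval_mul, Polynomial.eval_C, Polynomial.eval_pow, Polynomial.eval_X,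
      Polynomial.eval_add, Polynomial.eval_one]
    rw [mul_comm M, hM, ← integral_pow_inner_add_smul hy hu hyu]
    have : ∀ x : EuclideanSpace ℝ (Fin d), (inner ℝ x (y + s • u) : ℝ) ^ (2 * (r + 1)) =
        ∑ i ∈ Finset.range (2 * (r + 1) + 1), (((2 * (r + 1)).choose i : ℝ) * s ^ i) *
          ((inner ℝ x u : ℝ) ^ i * (inner ℝ x y) ^ (2 * (r + 1) - i)) := by
      intro x
      rw [inner_add_right, inner_smul_right, add_comm, add_pow]
      exact Finset.sum_congr rfl fun i _ => by ring
    simp only [this]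
    rw [integral_finsetSum]
    · refine Finset.sum_congr rfl fun i _ => ?_
      rw [integral_const_mul]
      ring
    · exact fun i _ => integrable_unifSphere hd (by fun_prop)
  have h2 := congrArg (fun p => Polynomial.coeff p 2) hpoly
  simp only [Polynomial.finsetSum_coeff, Polynomial.coeff_C_mul, Polynomial.coeff_X_pow,
    mul_ite, mul_one, mul_zero] at h2
  rw [Finset.sum_ite_eq, if_pos (Finset.mem_range.2 (by omega)),
    show Polynomial.coeff (Polynomial.expand ℝ 2 ((1 + Polynomial.X) ^ (r + 1))) 2 =
      ((r + 1 : ℕ) : ℝ) by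
      rw [Polynomial.coeff_expand (by norm_num), if_pos (by norm_num),
        Polynomial.coeff_one_add_X_pow]
      simp] at h2
  have hch : ((2 * (r + 1)).choose 2 : ℝ) = (r + 1) * (2 * r + 1) := by
    rw [Nat.cast_choose_two]
    push_cast
    ring
  simp only [c, hch, show 2 * (r + 1) - 2 = 2 * r by omega] at h2
  have hr : ((r : ℝ) + 1) ≠ 0 := by positivity
  apply mul_left_cancel₀ hr
  rw [show 2 * r + 2 = 2 * (r + 1) by ring, ← hM]
  push_cast at h2
  simp only [mul_comm ((inner ℝ _ u : ℝ) ^ 2)] at h2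
  linarith

lemma integral_inner_pow_succ (hd : 1 ≤ d) {y : EuclideanSpace ℝ (Fin d)} (hy : ‖y‖ = 1) (r : ℕ) :
    (2 * r + d) * ∫ x, (inner ℝ x y : ℝ) ^ (2 * r + 2) ∂(unifSphere d) =
      (2 * r + 1) * ∫ x, (inner ℝ x y : ℝ) ^ (2 * r) ∂(unifSphere d) := by
  have hy' : Orthonormal ℝ (Set.domRestrict ({⟨0, hd⟩} : Set (Fin d)) fun _ : Fin d => y) :=
    ⟨fun _ => hy, fun i j hij => (hij (Subsingleton.elim i j)).elim⟩
  obtain ⟨b, hb⟩ := hy'.exists_orthonormalBasis_extension_of_card_eq (by simp)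
  replace hb : b ⟨0, hd⟩ = y := hb _ rfl
  -- Insert `1 = ‖x‖²`, expanded in an orthonormal basis containing `y`. The direction `y` itself
  -- gives the full moment of order `2r + 2`, each other direction the fraction `1 / (2r + 1)` of
  -- it.
  have hsum : ∫ x, (inner ℝ x y : ℝ) ^ (2 * r) ∂(unifSphere d) =
      ∑ j, ∫ x, (inner ℝ x y : ℝ) ^ (2 * r) * (inner ℝ x (b j)) ^ 2 ∂(unifSphere d) := by
    rw [← integral_finsetSum]
    · refine integral_congr_ae ?_
      filter_upwards [ae_norm_eq_one_unifSphere d] with x hx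
      rw [← Finset.mul_sum]
      have := b.sum_sq_norm_inner_left x
      simp only [Real.norm_eq_abs, sq_abs, hx] at this
      rw [this]
      ring
    · exact fun i _ => integrable_unifSphere hd (by fun_prop)
  have hterm : ∀ j, (2 * (r : ℝ) + 1) *
      ∫ x, (inner ℝ x y : ℝ) ^ (2 * r) * (inner ℝ x (b j)) ^ 2 ∂(unifSphere d) =
      ∫ x, (inner ℝ x y : ℝ) ^ (2 * r + 2) ∂(unifSphere d) +
      if j = ⟨0, hd⟩ then 2 * r * ∫ x, (inner ℝ x y : ℝ) ^ (2 * r + 2) ∂(unifSphere d) else 0 := by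
    intro j
    split_ifs with hj
    · rw [hj, hb]
      simp only [← pow_add]
      ring
    · rw [add_zero]
      refine integral_pow_mul_sq hd hy (b.norm_eq_one j) ?_ r
      rw [← hb]
      exact b.orthonormal.2 (Ne.symm hj)
  rw [hsum, Finset.mul_sum, Finset.sum_congr rfl fun j _ => hterm j, Finset.sum_add_distrib]
  simp
  ring

lemma sphereExp_X_pow_odd (r : ℕ) : sphereExp d hd (Polynomial.X ^ (2 * r + 1)) = 0 := by
  have h := sphereExp_comp_neg hd (Polynomial.X ^ (2 * r + 1))
  rw [Polynomial.X_pow_comp, Odd.neg_pow ⟨r, rfl⟩, map_neg] at h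
  linarith

lemma sphereExp_X_pow_even_succ (r : ℕ) :
    (2 * r + d) * sphereExp d hd (Polynomial.X ^ (2 * r + 2)) =
      (2 * r + 1) * (d * sphereExp d hd (Polynomial.X ^ (2 * r))) := by
  obtain ⟨y, hy⟩ := exists_unit_vector hd
  have hsq : √(d : ℝ) ^ 2 = d := Real.sq_sqrt (by positivity)
  rw [sphereExp_eq_integral_unifSphere hd hy, sphereExp_eq_integral_unifSphere hd hy]
  simp only [Polynomial.eval_pow, Polynomial.eval_X, mul_pow, integral_const_mul]
  have h := integral_inner_pow_succ hd hy r
  rw [pow_add, hsq]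
  linear_combination √(d : ℝ) ^ (2 * r) * d * h

/-- The Pearson identity for the law of a coordinate on the sphere. -/
lemma sphereExp_pearson (g : Polynomial ℝ) :
    ((d : ℝ) - 1) * sphereExp d hd (Polynomial.X * g) =
      sphereExp d hd ((Polynomial.C (d : ℝ) - Polynomial.X ^ 2) * Polynomial.derivative g) := by
  induction g using Polynomial.induction_on' with
  | add p q hp hq => simp only [mul_add, map_add, hp, hq]
  | monomial n a =>
    rw [← Polynomial.C_mul_X_pow_eq_monomial, ← Polynomial.smul_eq_C_mul,
      Polynomial.derivative_smul, mul_smul_comm, mul_smul_comm, map_smul, map_smul, smul_eq_mul,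
      smul_eq_mul, mul_left_comm]
    congr 1
    rcases n with _ | m
    · have := sphereExp_X_pow_odd hd 0
      simp at this
      simp [this]
    · rw [Polynomial.derivative_X_pow, ← pow_succ',
        Nat.add_sub_cancel, show (Polynomial.C (d : ℝ) - Polynomial.X ^ 2) *
          (Polynomial.C ((m + 1 : ℕ) : ℝ) * Polynomial.X ^ m) =
          ((m + 1 : ℕ) : ℝ) • ((d : ℝ) • Polynomial.X ^ m - Polynomial.X ^ (m + 2)) by
          simp only [Polynomial.smul_eq_C_mul, map_natCast]; ring,
        map_smul, map_sub, map_smul, smul_eq_mul, smul_eq_mul]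
      -- On monomials the identity is the moment recursion (even `m`) or the vanishing of odd
      -- moments (odd `m`).
      rcases Nat.even_or_odd' m with ⟨r, rfl | rfl⟩
      · have := sphereExp_X_pow_even_succ hd r
        push_cast
        linear_combination this
      · have h1 := sphereExp_X_pow_odd hd r
        have h2 := sphereExp_X_pow_odd hd (r + 1)
        rw [show 2 * (r + 1) + 1 = 2 * r + 1 + 1 + 1 by ring] at h2
        rw [h1, h2]
        simp

/-- The even moments of `sphereLaw d` are bounded uniformly in `d`. -/
lemma sphereExp_X_pow_le (r : ℕ) :
    sphereExp d hd (Polynomial.X ^ (2 * r)) ≤ ∏ i ∈ Finset.range r, (2 * (i : ℝ) + 1) := by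
  induction r with
  | zero => simp [sphereExp_one]
  | succ r ih =>
    have h := sphereExp_X_pow_even_succ hd r
    have h0 : 0 ≤ sphereExp d hd (Polynomial.X ^ (2 * r + 2)) := by
      rw [show 2 * r + 2 = (r + 1) * 2 by ring, pow_mul]
      exact sphereExp_sq_nonneg hd _
    have hd0 : (0 : ℝ) < d := by exact_mod_cast hd
    have h1 : sphereExp d hd (Polynomial.X ^ (2 * r + 2)) ≤
        (2 * r + 1) * sphereExp d hd (Polynomial.X ^ (2 * r)) := by
      refine le_of_mul_le_mul_left ?_ hd0
      have : (0 : ℝ) ≤ 2 * r := by positivity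
      nlinarith
    rw [Finset.prod_range_succ, show 2 * (r + 1) = 2 * r + 2 by ring]
    have : (0 : ℝ) ≤ 2 * r + 1 := by positivity
    nlinarith

end SphereLaw

/-! ### Orthonormality, differential equation and three-term recurrence. -/

section GramSchmidt

variable {d : ℕ}

lemma sphereExp_C_mul (hd : 1 ≤ d) (c : ℝ) (p : Polynomial ℝ) :
    sphereExp d hd (Polynomial.C c * p) = c * sphereExp d hd p := by
  rw [← Polynomial.smul_eq_C_mul, map_smul, smul_eq_mul]

lemma gegenbauer_eq (hd : 2 ≤ d) (k : ℕ) : ∃ r : Polynomial ℝ,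
    r = Polynomial.X ^ k - ∑ i ∈ Finset.range k,
      Polynomial.C (sphereExp d (one_le_two.trans hd) (Polynomial.X ^ k * gegenbauer d i)) *
        gegenbauer d i ∧
    gegenbauer d k = Polynomial.C ((√(sphereExp d (one_le_two.trans hd) (r ^ 2)))⁻¹) * r := by
  refine ⟨_, rfl, ?_⟩
  rw [gegenbauer]
  simp only [sphereExp_apply, Polynomial.eval_mul, Polynomial.eval_pow, Polynomial.eval_X]
  simp only [Finset.sum_range]

/-- The claims are proved jointly: the lower degrees make the residual `r` monic of degree `k`,
hence nonzero and of positive norm, and lower orthonormality makes it orthogonal to its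
predecessors. -/
lemma degree_gegenbauer_and_orthonormal (hd : 2 ≤ d) (k : ℕ) : (gegenbauer d k).degree = k ∧
    (∀ j < k, sphereExp d (one_le_two.trans hd) (gegenbauer d k * gegenbauer d j) = 0) ∧
    sphereExp d (one_le_two.trans hd) (gegenbauer d k ^ 2) = 1 := by
  induction k using Nat.strong_induction_on with
  | _ k ih =>
    obtain ⟨r, hr, hq⟩ := gegenbauer_eq hd k
    have hdeg : r.degree = k := by
      rw [hr, Polynomial.degree_sub_eq_left_of_degree_lt, Polynomial.degree_X_pow]
      rw [Polynomial.degree_X_pow]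
      refine (Polynomial.degree_sum_le _ _).trans_lt ?_
      refine (Finset.sup_lt_iff (WithBot.bot_lt_coe k)).2 fun i hi => ?_
      rw [Finset.mem_range] at hi
      rw [← Polynomial.smul_eq_C_mul]
      refine (Polynomial.degree_smul_le _ _).trans_lt ?_
      rw [(ih i hi).1]
      exact Nat.cast_lt.2 hi
    have hr0 : r ≠ 0 := by
      rintro rfl
      simp at hdeg
    have hpos : 0 < sphereExp d (one_le_two.trans hd) (r ^ 2) := by
      refine lt_of_le_of_ne (sphereExp_sq_nonneg _ r) fun h => hr0 ?_
      exact eq_zero_of_sphereExp_sq_eq_zero hd h.symm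
    have hs : √(sphereExp d (one_le_two.trans hd) (r ^ 2)) ≠ 0 := (Real.sqrt_pos.2 hpos).ne'
    refine ⟨?_, ?_, ?_⟩
    · rw [hq, Polynomial.degree_C_mul (inv_ne_zero hs), hdeg]
    · intro j hj
      have horth : ∀ i ∈ Finset.range k, sphereExp d (one_le_two.trans hd)
          (Polynomial.C (sphereExp d (one_le_two.trans hd) (Polynomial.X ^ k * gegenbauer d i)) *
          gegenbauer d i * gegenbauer d j) =
          if i = j then sphereExp d (one_le_two.trans hd) (Polynomial.X ^ k * gegenbauer d j)
          else 0 := by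
        intro i hi
        rw [Finset.mem_range] at hi
        rw [mul_assoc, sphereExp_C_mul]
        split_ifs with hij
        · rw [hij, ← sq, (ih j hj).2.2, mul_one]
        · rcases lt_or_gt_of_ne hij with h | h
          · rw [mul_comm (gegenbauer d i), (ih j hj).2.1 i h, mul_zero]
          · rw [(ih i hi).2.1 j h, mul_zero]
      rw [hq, mul_assoc, sphereExp_C_mul, hr, sub_mul, map_sub, Finset.sum_mul, map_sum,
        Finset.sum_congr rfl horth, Finset.sum_ite_eq', if_pos (Finset.mem_range.2 hj), sub_self,
        mul_zero]
    · rw [hq, mul_pow, ← Polynomial.C_pow, sphereExp_C_mul, inv_pow, Real.sq_sqrt hpos.le,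
        inv_mul_cancel₀ hpos.ne']

lemma degree_gegenbauer (hd : 2 ≤ d) (k : ℕ) : (gegenbauer d k).degree = k :=
  (degree_gegenbauer_and_orthonormal hd k).1

lemma sphereExp_gegenbauer_sq (hd : 2 ≤ d) (k : ℕ) :
    sphereExp d (one_le_two.trans hd) (gegenbauer d k ^ 2) = 1 :=
  (degree_gegenbauer_and_orthonormal hd k).2.2

lemma coeff_gegenbauer_ne_zero (hd : 2 ≤ d) (k : ℕ) : (gegenbauer d k).coeff k ≠ 0 :=
  Polynomial.coeff_ne_zero_of_eq_degree (degree_gegenbauer hd k)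

lemma coeff_gegenbauer_of_lt (hd : 2 ≤ d) {k m : ℕ} (h : k < m) : (gegenbauer d k).coeff m = 0 :=
  Polynomial.coeff_eq_zero_of_degree_lt (by rw [degree_gegenbauer hd]; exact_mod_cast h)

/-- Subtracting a multiple of a Gegenbauer polynomial lowers the degree. -/
lemma exists_degree_sub_gegenbauer_lt (hd : 2 ≤ d) {m : ℕ} {p : Polynomial ℝ}
    (hp : p.degree < (m + 1 : ℕ)) :
    ∃ (c : ℝ) (r : Polynomial ℝ), r.degree < m ∧ p = r + Polynomial.C c * gegenbauer d m := by
  refine ⟨p.coeff m / (gegenbauer d m).coeff m,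
    p - Polynomial.C (p.coeff m / (gegenbauer d m).coeff m) * gegenbauer d m, ?_, by ring⟩
  rw [Polynomial.degree_lt_iff_coeff_zero] at hp ⊢
  intro n hn
  rw [Polynomial.coeff_sub, Polynomial.coeff_C_mul]
  rcases hn.eq_or_lt with rfl | h
  · rw [div_mul_cancel₀ _ (coeff_gegenbauer_ne_zero hd m), sub_self]
  · rw [hp n h, coeff_gegenbauer_of_lt hd h]
    simp

lemma sphereExp_mul_gegenbauer_of_degree_lt (hd : 2 ≤ d) {k : ℕ} {p : Polynomial ℝ}
    (hp : p.degree < k) :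
    sphereExp d (one_le_two.trans hd) (p * gegenbauer d k) = 0 := by
  suffices ∀ m ≤ k, ∀ p : Polynomial ℝ, p.degree < m →
      sphereExp d (one_le_two.trans hd) (p * gegenbauer d k) = 0 from
    this k le_rfl p hp
  intro m
  induction m with
  | zero =>
    intro _ p hp
    rw [Polynomial.degree_lt_iff_coeff_zero] at hp
    have : p = 0 := Polynomial.ext fun n => by simpa using hp n (Nat.zero_le n)
    simp [this]
  | succ m ih =>
    intro hm p hp
    obtain ⟨c, r, hr, rfl⟩ := exists_degree_sub_gegenbauer_lt hd hp
    rw [add_mul, map_add, ih (by omega) r hr, mul_assoc, sphereExp_C_mul, mul_comm (gegenbauer d m),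
      (degree_gegenbauer_and_orthonormal hd k).2.1 m (by omega)]
    simp

lemma eq_sum_gegenbauer (hd : 2 ≤ d) {m : ℕ} {p : Polynomial ℝ} (hp : p.degree < m) :
    p = ∑ i ∈ Finset.range m,
      Polynomial.C (sphereExp d (one_le_two.trans hd) (p * gegenbauer d i)) *
        gegenbauer d i := by
  induction m generalizing p with
  | zero =>
    rw [Polynomial.degree_lt_iff_coeff_zero] at hp
    exact Polynomial.ext fun n => by simpa using hp n (Nat.zero_le n)
  | succ m ih =>
    obtain ⟨c, r, hr, rfl⟩ := exists_degree_sub_gegenbauer_lt hd hp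
    rw [Finset.sum_range_succ]
    congr 1
    · conv_lhs => rw [ih hr]
      refine Finset.sum_congr rfl fun i hi => ?_
      rw [add_mul, map_add, mul_assoc (Polynomial.C c), sphereExp_C_mul,
        (degree_gegenbauer_and_orthonormal hd m).2.1 i (Finset.mem_range.1 hi)]
      simp
    · rw [add_mul, map_add, sphereExp_mul_gegenbauer_of_degree_lt hd hr, mul_assoc,
        sphereExp_C_mul, ← sq, sphereExp_gegenbauer_sq hd]
      simp

lemma eq_zero_of_orthogonal (hd : 2 ≤ d) {m : ℕ} {p : Polynomial ℝ} (hp : p.degree < m)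
    (h : ∀ i < m, sphereExp d (one_le_two.trans hd) (p * gegenbauer d i) = 0) : p = 0 := by
  rw [eq_sum_gegenbauer hd hp]
  exact Finset.sum_eq_zero fun i hi => by simp [h i (Finset.mem_range.1 hi)]

/-- The Gegenbauer differential operator. -/
noncomputable def gegenbauerOp (d : ℕ) (g : Polynomial ℝ) : Polynomial ℝ :=
  (Polynomial.C (d : ℝ) - Polynomial.X ^ 2) * Polynomial.derivative (Polynomial.derivative g) -
    Polynomial.C ((d : ℝ) - 1) * (Polynomial.X * Polynomial.derivative g)

/-- Integration by parts: the Pearson identity applied to `g' h`. The right side is symmetric in `g`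
and `h`, so the operator is self-adjoint. -/
lemma sphereExp_gegenbauerOp_mul (hd : 1 ≤ d) (g h : Polynomial ℝ) :
    sphereExp d hd (gegenbauerOp d g * h) = -sphereExp d hd ((Polynomial.C (d : ℝ) -
      Polynomial.X ^ 2) * (Polynomial.derivative g * Polynomial.derivative h)) := by
  have := sphereExp_pearson hd (Polynomial.derivative g * h)
  rw [Polynomial.derivative_mul, mul_add, map_add, ← sphereExp_C_mul] at this
  rw [gegenbauerOp, sub_mul, map_sub, mul_assoc, mul_assoc, mul_assoc, this]
  ring

lemma sphereExp_gegenbauerOp_mul_comm (hd : 1 ≤ d) (g h : Polynomial ℝ) :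
    sphereExp d hd (gegenbauerOp d g * h) = sphereExp d hd (g * gegenbauerOp d h) := by
  rw [mul_comm g, sphereExp_gegenbauerOp_mul, sphereExp_gegenbauerOp_mul,
    mul_comm (Polynomial.derivative g)]

lemma coeff_gegenbauerOp (g : Polynomial ℝ) (n : ℕ) :
    (gegenbauerOp d g).coeff n = d * ((n + 2) * (n + 1)) * g.coeff (n + 2) -
      n * (n + d - 2) * g.coeff n := by
  rw [gegenbauerOp, sub_mul, Polynomial.coeff_sub, Polynomial.coeff_sub, Polynomial.coeff_C_mul,
    Polynomial.coeff_C_mul]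
  rcases n with _ | _ | n
  · simp [Polynomial.coeff_derivative]
    ring
  · simp [Polynomial.coeff_X_pow_mul', Polynomial.coeff_X_mul, Polynomial.coeff_derivative]
    ring
  · simp [Polynomial.coeff_X_pow_mul', Polynomial.coeff_X_mul, Polynomial.coeff_derivative]
    ring

/-- The eigenvalue is read off the leading coefficient, so the difference has degree below `k`;
since the operator is self-adjoint and does not raise degrees, the difference is also orthogonal to
all lower Gegenbauer polynomials. -/
lemma gegenbauerOp_gegenbauer (hd : 2 ≤ d) (k : ℕ) :
    gegenbauerOp d (gegenbauer d k) =
      -(Polynomial.C ((k : ℝ) * (k + d - 2)) * gegenbauer d k) := by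
  rw [eq_neg_iff_add_eq_zero]
  refine eq_zero_of_orthogonal hd (m := k) ?_ fun i hi => ?_
  · rw [Polynomial.degree_lt_iff_coeff_zero]
    intro n hn
    rw [Polynomial.coeff_add, Polynomial.coeff_C_mul, coeff_gegenbauerOp,
      coeff_gegenbauer_of_lt hd (show k < n + 2 by omega)]
    rcases hn.eq_or_lt with rfl | h
    · ring
    · rw [coeff_gegenbauer_of_lt hd h]
      ring
  · rw [add_mul, map_add, sphereExp_gegenbauerOp_mul_comm, mul_comm,
      sphereExp_mul_gegenbauer_of_degree_lt hd, mul_assoc, sphereExp_C_mul,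
      (degree_gegenbauer_and_orthonormal hd k).2.1 i hi]
    · simp
    · rw [Polynomial.degree_lt_iff_coeff_zero]
      intro n hn
      rw [coeff_gegenbauerOp, coeff_gegenbauer_of_lt hd (by omega),
        coeff_gegenbauer_of_lt hd (by omega)]
      simp

lemma gegenbauer_comp_neg (hd : 2 ≤ d) (k : ℕ) :
    (gegenbauer d k).comp (-Polynomial.X) = Polynomial.C ((-1) ^ k) * gegenbauer d k := by
  have hdeg : ∀ (j n : ℕ), ((gegenbauer d j).comp (-Polynomial.X)).coeff n =
      (-1) ^ n * (gegenbauer d j).coeff n := fun j n => by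
    rw [show (-Polynomial.X : Polynomial ℝ) = Polynomial.C (-1) * Polynomial.X by simp,
      Polynomial.comp_C_mul_X_coeff, mul_comm]
  rw [← sub_eq_zero]
  refine eq_zero_of_orthogonal hd (m := k) ?_ fun i hi => ?_
  · rw [Polynomial.degree_lt_iff_coeff_zero]
    intro n hn
    rw [Polynomial.coeff_sub, Polynomial.coeff_C_mul, hdeg]
    rcases hn.eq_or_lt with rfl | h
    · ring
    · rw [coeff_gegenbauer_of_lt hd h]
      ring
  · rw [sub_mul, map_sub, mul_assoc, sphereExp_C_mul,
      (degree_gegenbauer_and_orthonormal hd k).2.1 i hi, ← sphereExp_comp_neg, Polynomial.mul_comp,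
      Polynomial.comp_assoc]
    simp only [Polynomial.neg_comp, Polynomial.X_comp, neg_neg, Polynomial.comp_X]
    rw [mul_comm, sphereExp_mul_gegenbauer_of_degree_lt hd]
    · simp
    · rw [Polynomial.degree_lt_iff_coeff_zero]
      intro n hn
      rw [hdeg, coeff_gegenbauer_of_lt hd (by omega), mul_zero]

lemma sphereExp_X_mul_gegenbauer_sq (hd : 2 ≤ d) (k : ℕ) :
    sphereExp d (one_le_two.trans hd) (Polynomial.X * gegenbauer d k * gegenbauer d k) = 0 := by
  have h := sphereExp_comp_neg (one_le_two.trans hd)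
    (Polynomial.X * gegenbauer d k * gegenbauer d k)
  rw [Polynomial.mul_comp, Polynomial.mul_comp, gegenbauer_comp_neg hd, Polynomial.X_comp,
    show -Polynomial.X * (Polynomial.C ((-1) ^ k) * gegenbauer d k) *
      (Polynomial.C ((-1) ^ k) * gegenbauer d k) =
      Polynomial.C (-((-1) ^ k * (-1) ^ k)) * (Polynomial.X * gegenbauer d k * gegenbauer d k) by
      simp only [map_neg, map_mul]; ring, sphereExp_C_mul, ← mul_pow] at h
  norm_num at h
  linarith

/-- The off-diagonal recurrence coefficient of the Gegenbauer polynomials. -/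
noncomputable def recCoeff (d k : ℕ) : ℝ :=
  ∫ t, (Polynomial.X * gegenbauer d k * gegenbauer d (k + 1)).eval t ∂(sphereLaw d)

lemma degree_X_mul_gegenbauer_lt (hd : 2 ≤ d) {k m : ℕ} (h : k + 1 < m) :
    (Polynomial.X * gegenbauer d k).degree < (m : WithBot ℕ) := by
  rw [Polynomial.degree_mul, Polynomial.degree_X, degree_gegenbauer hd, add_comm]
  exact_mod_cast h

/-- Multiplication by `X` is symmetric and raises degrees by one, so only the adjacent degrees and
the diagonal survive; the diagonal term vanishes by parity. -/
lemma X_mul_gegenbauer (hd : 2 ≤ d) (k : ℕ) : Polynomial.X * gegenbauer d (k + 1) =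
    Polynomial.C (recCoeff d (k + 1)) * gegenbauer d (k + 2) +
      Polynomial.C (recCoeff d k) * gegenbauer d k := by
  have h := eq_sum_gegenbauer hd (degree_X_mul_gegenbauer_lt hd (show k + 1 + 1 < k + 3 by omega))
  rw [Finset.sum_range_succ, Finset.sum_range_succ, Finset.sum_range_succ,
    sphereExp_X_mul_gegenbauer_sq hd, Finset.sum_eq_zero, zero_add, map_zero, zero_mul, add_zero,
    add_comm (Polynomial.C _ * _)] at h
  · rw [show Polynomial.X * gegenbauer d (k + 1) * gegenbauer d k =
      Polynomial.X * gegenbauer d k * gegenbauer d (k + 1) by ring] at h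
    exact h
  · intro i hi
    rw [Finset.mem_range] at hi
    rw [show Polynomial.X * gegenbauer d (k + 1) * gegenbauer d i =
      Polynomial.X * gegenbauer d i * gegenbauer d (k + 1) by ring,
      sphereExp_mul_gegenbauer_of_degree_lt hd (degree_X_mul_gegenbauer_lt hd (by omega))]
    simp

lemma X_mul_gegenbauer_zero (hd : 2 ≤ d) : Polynomial.X * gegenbauer d 0 =
    Polynomial.C (recCoeff d 0) * gegenbauer d 1 := by
  have h := eq_sum_gegenbauer hd (degree_X_mul_gegenbauer_lt hd (show 0 + 1 < 2 by omega))
  rw [Finset.sum_range_succ, Finset.sum_range_succ, sphereExp_X_mul_gegenbauer_sq hd,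
    Finset.sum_range_zero, map_zero, zero_mul, zero_add, zero_add] at h
  exact h

lemma gegenbauer_zero (hd : 2 ≤ d) : gegenbauer d 0 = 1 := by
  obtain ⟨r, hr, hq⟩ := gegenbauer_eq hd 0
  have : r = 1 := by simpa using hr
  rw [hq, this]
  simp [sphereExp_one]

end GramSchmidt

/-! ### The value at `√d`, the dimension `N_k`, and uniform moment bounds. -/

section NormalizationConstants

variable {d : ℕ}

/-- The value of the normalized Gegenbauer polynomial at the right end `√d` of the support. -/
noncomputable def gegenbauerEnd (d k : ℕ) : ℝ := (gegenbauer d k).eval √(d : ℝ)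

lemma gegenbauerEnd_zero (hd : 2 ≤ d) : gegenbauerEnd d 0 = 1 := by
  simp [gegenbauerEnd, gegenbauer_zero hd]

/-- At `√d` the coefficient `d - X²` of the second derivative vanishes, so the differential equation
determines the first derivative from the value. -/
lemma derivative_gegenbauer_eval_end (hd : 2 ≤ d) (k : ℕ) :
    ((d : ℝ) - 1) * (√(d : ℝ) * (Polynomial.derivative (gegenbauer d k)).eval √(d : ℝ)) =
      k * (k + d - 2) * gegenbauerEnd d k := by
  have h := congrArg (Polynomial.eval √(d : ℝ)) (gegenbauerOp_gegenbauer hd k)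
  have hsq : √(d : ℝ) ^ 2 = d := Real.sq_sqrt (by positivity)
  rw [gegenbauerOp] at h
  simp only [Polynomial.eval_sub, Polynomial.eval_mul, Polynomial.eval_C, Polynomial.eval_pow,
    Polynomial.eval_X, Polynomial.eval_neg, hsq, sub_self, zero_mul, zero_sub] at h
  rw [gegenbauerEnd]
  linarith

lemma recCoeff_zero_mul_end (hd : 2 ≤ d) : recCoeff d 0 * gegenbauerEnd d 1 = √(d : ℝ) := by
  have h := congrArg (Polynomial.eval √(d : ℝ)) (X_mul_gegenbauer_zero hd)
  simp only [gegenbauer_zero hd, Polynomial.eval_mul, Polynomial.eval_X, Polynomial.eval_C,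
    mul_one] at h
  exact h.symm

/-- The recurrence and its derivative at `√d` are two linear equations for the products `recCoeff d
(k + 1) * gegenbauerEnd d (k + 2)` and `recCoeff d k * gegenbauerEnd d k`; this is their solution.
-/
lemma recCoeff_succ_mul_end (hd : 2 ≤ d) (k : ℕ) :
    recCoeff d (k + 1) * gegenbauerEnd d (k + 2) * (2 * k + d) =
      √(d : ℝ) * gegenbauerEnd d (k + 1) * (k + d - 1) ∧
    recCoeff d k * gegenbauerEnd d k * (2 * k + d) =
      √(d : ℝ) * gegenbauerEnd d (k + 1) * (k + 1) := by
  have h0 := congrArg (Polynomial.eval √(d : ℝ)) (X_mul_gegenbauer hd k)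
  have h1 := congrArg (fun p => ((d : ℝ) - 1) * (√(d : ℝ) *
    (Polynomial.derivative p).eval √(d : ℝ))) (X_mul_gegenbauer hd k)
  have hs := derivative_gegenbauer_eval_end hd
  have e0 := hs k
  have e1 := hs (k + 1)
  have e2 := hs (k + 2)
  simp only [Polynomial.derivative_mul, Polynomial.derivative_add, Polynomial.derivative_C,
    Polynomial.derivative_X, Polynomial.eval_add, Polynomial.eval_mul, Polynomial.eval_X,
    Polynomial.eval_C, zero_mul, one_mul, zero_add] at h0 h1
  simp only [gegenbauerEnd] at *
  push_cast at e0 e1 e2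
  set s0 := (gegenbauer d k).eval √(d : ℝ)
  set s1 := (gegenbauer d (k + 1)).eval √(d : ℝ)
  set s2 := (gegenbauer d (k + 2)).eval √(d : ℝ)
  have key : (k + 2) * (k + 2 + d - 2) * (recCoeff d (k + 1) * s2) +
      k * (k + d - 2) * (recCoeff d k * s0) =
      √(d : ℝ) * ((d - 1) * s1 + (k + 1) * (k + 1 + d - 2) * s1) := by
    linear_combination (-recCoeff d (k + 1)) * e2 + (-recCoeff d k) * e0 + √(d : ℝ) * e1 - h1
  constructor
  · have : (2 : ℝ) ≠ 0 := two_ne_zero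
    apply mul_left_cancel₀ this
    linear_combination key + k * (k + d - 2) * h0
  · apply mul_left_cancel₀ (two_ne_zero : (2 : ℝ) ≠ 0)
    linear_combination -key - (k + 2) * (k + 2 + d - 2) * h0

lemma recCoeff_mul_end (hd : 2 ≤ d) (k : ℕ) :
    recCoeff d k * gegenbauerEnd d (k + 1) * (2 * k + d - 2) =
      √(d : ℝ) * gegenbauerEnd d k * (k + d - 2) := by
  rcases k with _ | k
  · rw [zero_add, recCoeff_zero_mul_end hd, gegenbauerEnd_zero hd]
    push_cast
    ring
  · push_cast
    linear_combination (recCoeff_succ_mul_end hd k).1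

lemma gegenbauerEnd_ne_zero (hd : 2 ≤ d) (k : ℕ) : gegenbauerEnd d k ≠ 0 := by
  have hd' : (2 : ℝ) ≤ d := by exact_mod_cast hd
  have hs : 0 < √(d : ℝ) := Real.sqrt_pos.2 (by linarith)
  induction k with
  | zero => simp [gegenbauerEnd_zero hd]
  | succ k ih =>
    intro h
    rcases k with _ | k
    · have := recCoeff_zero_mul_end hd
      rw [h] at this
      simp only [mul_zero] at this
      exact hs.ne this
    · have h1 := (recCoeff_succ_mul_end hd k).1
      rw [h] at h1
      have : (k : ℝ) + d - 1 ≠ 0 := by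
        have : (0 : ℝ) ≤ k := by positivity
        linarith
      simp only [mul_zero, zero_mul, zero_eq_mul, this, or_false] at h1
      exact mul_ne_zero hs.ne' ih h1

lemma gegenbauerEnd_one_sq (hd : 2 ≤ d) : gegenbauerEnd d 1 ^ 2 = d := by
  have hd' : (0 : ℝ) < d := by exact_mod_cast (by omega : 0 < d)
  have hsq : √(d : ℝ) ^ 2 = d := Real.sq_sqrt hd'.le
  have h1 := (recCoeff_succ_mul_end hd 0).2
  have h2 := recCoeff_zero_mul_end hd
  rw [gegenbauerEnd_zero hd] at h1
  have hs : √(d : ℝ) ≠ 0 := (Real.sqrt_pos.2 hd').ne'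
  simp only [Nat.cast_zero, mul_zero, zero_add, mul_one] at h1
  apply mul_left_cancel₀ hs
  linear_combination (-gegenbauerEnd d 1) * h1 + d * h2

/-- Eliminate `recCoeff d k` between its two expressions through neighbouring end values.
Multiplying the two instead yields `recCoeff_sq`. -/
lemma gegenbauerEnd_sq_succ (hd : 2 ≤ d) (k : ℕ) :
    gegenbauerEnd d (k + 1) ^ 2 * ((k + 1) * (2 * k + d - 2)) =
      gegenbauerEnd d k ^ 2 * ((k + d - 2) * (2 * k + d)) := by
  have hd' : (0 : ℝ) < d := by exact_mod_cast (by omega : 0 < d)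
  have hs : √(d : ℝ) ≠ 0 := (Real.sqrt_pos.2 hd').ne'
  have h1 := (recCoeff_succ_mul_end hd k).2
  have h2 := recCoeff_mul_end hd k
  apply mul_left_cancel₀ hs
  linear_combination (-gegenbauerEnd d (k + 1) * (2 * k + d - 2)) * h1 +
    gegenbauerEnd d k * (2 * k + d) * h2

lemma harmonicDim_succ_succ (hd : 2 ≤ d) (k : ℕ) :
    harmonicDim d (k + 2) * ((k + 2) * (2 * k + d)) =
      harmonicDim d (k + 1) * ((k + d - 1) * (2 * k + d + 2)) := by
  obtain ⟨e, rfl⟩ := Nat.exists_eq_add_of_le hd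
  have h := Nat.add_one_mul_choose_eq (k + e) k
  have h' : ((k : ℝ) + e + 1) * ((k + e).choose k) = ((k + e + 1).choose (k + 1)) * (k + 1) := by
    exact_mod_cast h
  simp only [harmonicDim, Nat.add_eq_zero_iff, one_ne_zero, OfNat.ofNat_ne_zero, and_false,
    if_false]
  rw [show k + 2 + (2 + e) - 3 = k + e + 1 by omega, show k + 1 + (2 + e) - 3 = k + e by omega,
    show k + 2 - 1 = k + 1 by omega, Nat.add_sub_cancel]
  push_cast
  field_simp
  linear_combination (-(2 * k + 4 + e) * (2 * k + 2 + e)) * h'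

lemma gegenbauerEnd_sq (hd : 2 ≤ d) (k : ℕ) : gegenbauerEnd d k ^ 2 = harmonicDim d k := by
  rcases k with _ | k
  · simp [gegenbauerEnd_zero hd, harmonicDim]
  -- The induction starts at degree one, because for `d = 2` the ratio recursion at `k = 0` reads `0
  -- = 0`.
  induction k with
  | zero => rw [zero_add, gegenbauerEnd_one_sq hd]; simp [harmonicDim]
  | succ k ih =>
    have hd' : (2 : ℝ) ≤ d := by exact_mod_cast hd
    have h : ((k : ℝ) + 2) * (2 * k + d) ≠ 0 := by positivity
    apply mul_right_cancel₀ h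
    rw [harmonicDim_succ_succ hd, ← ih]
    have := gegenbauerEnd_sq_succ hd (k + 1)
    push_cast at this
    linear_combination this

lemma one_le_harmonicDim (hd : 2 ≤ d) (k : ℕ) : 1 ≤ harmonicDim d k := by
  rcases k with _ | k
  · simp [harmonicDim]
  · have hd' : (2 : ℝ) ≤ d := by exact_mod_cast hd
    have hc : (1 : ℝ) ≤ ((k + 1 + d - 3).choose (k + 1 - 1) : ℝ) := by
      exact_mod_cast Nat.choose_pos (by omega)
    have hk : (0 : ℝ) < k + 1 := by positivity
    simp only [harmonicDim, Nat.succ_ne_zero, if_false]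
    push_cast at hc ⊢
    have h1 : (1 : ℝ) ≤ (2 * (k + 1) + d - 2) / (k + 1) := by
      rw [le_div_iff₀ hk]
      linarith
    exact one_le_mul_of_one_le_of_one_le h1 hc

lemma abs_gegenbauerEnd (hd : 2 ≤ d) (k : ℕ) : |gegenbauerEnd d k| = √(harmonicDim d k) := by
  rw [← gegenbauerEnd_sq hd, Real.sqrt_sq_eq_abs]

lemma exists_le_harmonicDim (k : ℕ) :
    ∃ c : ℝ, 0 < c ∧ ∀ d : ℕ, 2 ≤ d → c * (d : ℝ) ^ k ≤ harmonicDim d k := by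
  rcases k with _ | k
  · exact ⟨1, one_pos, fun d _ => by simp [harmonicDim]⟩
  induction k with
  | zero => exact ⟨1, one_pos, fun d _ => by simp [harmonicDim]⟩
  | succ k ih =>
    obtain ⟨c, hc, h⟩ := ih
    -- The ratio of consecutive dimensions is at least `d / (2 (k + 2))`, since `d ≤ 2 (d - 1)`.
    refine ⟨c / (2 * (k + 2)), by positivity, fun d hd => ?_⟩
    have hd' : (2 : ℝ) ≤ d := by exact_mod_cast hd
    have hk : (0 : ℝ) ≤ k := by positivity
    have h1 := harmonicDim_succ_succ hd k
    have h2 := h d hd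
    have h0 : 0 ≤ harmonicDim d (k + 1) := zero_le_one.trans (one_le_harmonicDim hd _)
    rw [div_mul_eq_mul_div, div_le_iff₀ (by positivity), pow_succ, ← mul_assoc]
    have hpos : (0 : ℝ) < 2 * k + d := by positivity
    refine le_of_mul_le_mul_right ?_ hpos
    calc c * (d : ℝ) ^ (k + 1) * d * (2 * k + d) ≤ harmonicDim d (k + 1) * d * (2 * k + d) := by
          gcongr
      _ = harmonicDim d (k + 1) * (d * (2 * k + d)) := by ring
      _ ≤ harmonicDim d (k + 1) * (2 * ((k + d - 1) * (2 * k + d + 2))) := by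
          apply mul_le_mul_of_nonneg_left _ h0
          nlinarith
      _ = 2 * (harmonicDim d (k + 1) * ((k + d - 1) * (2 * k + d + 2))) := by ring
      _ = harmonicDim d (k + 2) * (2 * (k + 2)) * (2 * k + d) := by rw [← h1]; ring

lemma recCoeff_sq (hd : 2 ≤ d) (k : ℕ) :
    recCoeff d k ^ 2 * ((2 * k + d - 2) * (2 * k + d)) = d * ((k + 1) * (k + d - 2)) := by
  have hsq : √(d : ℝ) ^ 2 = d := Real.sq_sqrt (by positivity)
  have h1 := (recCoeff_succ_mul_end hd k).2
  have h2 := recCoeff_mul_end hd k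
  have hne := mul_ne_zero (gegenbauerEnd_ne_zero hd k) (gegenbauerEnd_ne_zero hd (k + 1))
  apply mul_left_cancel₀ hne
  linear_combination recCoeff d k * gegenbauerEnd d (k + 1) * (2 * k + d - 2) * h1 +
    √(d : ℝ) * gegenbauerEnd d (k + 1) * (k + 1) * h2 +
    gegenbauerEnd d k * gegenbauerEnd d (k + 1) * ((k + 1) * (k + d - 2)) * hsq

lemma recCoeff_sq_bounds (hd : 2 ≤ d) (k : ℕ) :
    1 / 2 ≤ recCoeff d k ^ 2 ∧ recCoeff d k ^ 2 ≤ k + 1 := by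
  have hd' : (2 : ℝ) ≤ d := by exact_mod_cast hd
  rcases k with _ | k
  · have h1 := (recCoeff_succ_mul_end hd 0).2
    have h2 := recCoeff_zero_mul_end hd
    rw [gegenbauerEnd_zero hd] at h1
    have hs : √(d : ℝ) ≠ 0 := (Real.sqrt_pos.2 (by linarith)).ne'
    have : recCoeff d 0 ^ 2 = 1 := by
      simp only [Nat.cast_zero, mul_zero, zero_add, mul_one] at h1
      have hne : (d : ℝ) ≠ 0 := by positivity
      apply mul_left_cancel₀ hne
      have hsq : √(d : ℝ) ^ 2 = d := Real.sq_sqrt (by positivity)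
      linear_combination recCoeff d 0 * h1 + √(d : ℝ) * h2 + hsq
    rw [this]
    norm_num
  · have h := recCoeff_sq hd (k + 1)
    push_cast at h ⊢
    have hk : (0 : ℝ) ≤ k := by positivity
    have hpos : (0 : ℝ) < (2 * (k + 1) + d - 2) * (2 * (k + 1) + d) := by
      apply mul_pos <;> linarith
    constructor
    · refine le_of_mul_le_mul_right ?_ hpos
      rw [h]
      have e1 : (2 * ((k : ℝ) + 1) + d - 2) ≤ 2 * (k + 1 + d - 2) := by linarith
      have e2 : (2 * ((k : ℝ) + 1) + d) ≤ d * (k + 1 + 1) := by nlinarith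
      have := mul_le_mul e1 e2 (by linarith) (by linarith)
      nlinarith
    · refine le_of_mul_le_mul_right ?_ hpos
      rw [h]
      have e1 : ((k : ℝ) + 1 + d - 2) ≤ (2 * (k + 1) + d - 2) := by linarith
      have e2 : (d : ℝ) ≤ (2 * (k + 1) + d) := by linarith
      have := mul_le_mul e1 e2 (by linarith) (by linarith)
      have hk1 : (0 : ℝ) ≤ k + 1 + 1 := by linarith
      nlinarith [mul_le_mul_of_nonneg_left this hk1]

/-- Solve the recurrence for `c f = X g - b h` and use convexity. Separating `X` from `g` doubles
the order of the moment of `g`, so an induction on the degree has to treat all orders at once. -/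
lemma moment_le_of_recurrence (hd : 1 ≤ d) {f g h : Polynomial ℝ} {c b B C₁ C₂ : ℝ} (p : ℕ)
    (hrec : Polynomial.X * g = Polynomial.C c * f + Polynomial.C b * h)
    (hc : 1 / 2 ≤ c ^ 2) (hb : b ^ 2 ≤ B)
    (hg : ∫ t, (g.eval t) ^ (2 * (2 * p)) ∂(sphereLaw d) ≤ C₁)
    (hh : ∫ t, (h.eval t) ^ (2 * p) ∂(sphereLaw d) ≤ C₂) :
    ∫ t, (f.eval t) ^ (2 * p) ∂(sphereLaw d) ≤ 2 ^ p * (2 ^ (2 * p - 1) *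
      ((∏ i ∈ Finset.range (2 * p), (2 * (i : ℝ) + 1) + C₁) / 2 + B ^ p * C₂)) := by
  have hX := sphereExp_X_pow_le hd (2 * p)
  simp only [sphereExp_apply, Polynomial.eval_pow, Polynomial.eval_X] at hX
  have hB : 0 ≤ B := (sq_nonneg b).trans hb
  have hpt : ∀ t : ℝ, (f.eval t) ^ (2 * p) ≤ 2 ^ p * (2 ^ (2 * p - 1) *
      ((t ^ (2 * (2 * p)) + (g.eval t) ^ (2 * (2 * p))) / 2 + B ^ p * (h.eval t) ^ (2 * p))) := by
    intro t
    have ht := congrArg (Polynomial.eval t) hrec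
    simp only [Polynomial.eval_add, Polynomial.eval_mul, Polynomial.eval_X, Polynomial.eval_C] at ht
    have e1 : (f.eval t) ^ (2 * p) ≤ 2 ^ p * (c * f.eval t) ^ (2 * p) := by
      rw [pow_mul, pow_mul, ← mul_pow]
      refine pow_le_pow_left₀ (sq_nonneg _) ?_ p
      rw [mul_pow]
      nlinarith [sq_nonneg (f.eval t)]
    have e2 : (c * f.eval t) ^ (2 * p) ≤
        2 ^ (2 * p - 1) * ((t * g.eval t) ^ (2 * p) + (-(b * h.eval t)) ^ (2 * p)) := by
      rw [show c * f.eval t = t * g.eval t + -(b * h.eval t) by linarith]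
      exact (even_two_mul p).add_pow_le
    have e3 : (t * g.eval t) ^ (2 * p) ≤
        (t ^ (2 * (2 * p)) + (g.eval t) ^ (2 * (2 * p))) / 2 := by
      rw [mul_pow, mul_comm 2 (2 * p), pow_mul t (2 * p) 2, pow_mul (g.eval t) (2 * p) 2]
      nlinarith [sq_nonneg (t ^ (2 * p) - (g.eval t) ^ (2 * p))]
    have e4 : (-(b * h.eval t)) ^ (2 * p) ≤ B ^ p * (h.eval t) ^ (2 * p) := by
      rw [(even_two_mul p).neg_pow, mul_pow, pow_mul b]
      exact mul_le_mul_of_nonneg_right (pow_le_pow_left₀ (sq_nonneg _) hb p)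
        ((even_two_mul p).pow_nonneg _)
    calc (f.eval t) ^ (2 * p) ≤ 2 ^ p * (c * f.eval t) ^ (2 * p) := e1
      _ ≤ 2 ^ p * (2 ^ (2 * p - 1) * ((t * g.eval t) ^ (2 * p) + (-(b * h.eval t)) ^ (2 * p))) := by
          gcongr
      _ ≤ _ := by gcongr
  have hi : ∀ (q : Polynomial ℝ) (m : ℕ), Integrable (fun t => (q.eval t) ^ m) (sphereLaw d) :=
    fun q m => integrable_sphereLaw hd (q.continuous.pow m)
  have hiX : ∀ m : ℕ, Integrable (fun t : ℝ => t ^ m) (sphereLaw d) :=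
    fun m => integrable_sphereLaw hd (continuous_pow m)
  have hi1 : Integrable (fun t : ℝ => (t ^ (2 * (2 * p)) + (g.eval t) ^ (2 * (2 * p))) / 2)
      (sphereLaw d) := ((hiX _).add (hi g _)).div_const 2
  calc ∫ t, (f.eval t) ^ (2 * p) ∂(sphereLaw d)
      ≤ ∫ t, 2 ^ p * (2 ^ (2 * p - 1) * ((t ^ (2 * (2 * p)) + (g.eval t) ^ (2 * (2 * p))) / 2 +
          B ^ p * (h.eval t) ^ (2 * p))) ∂(sphereLaw d) :=
        integral_mono (hi f _) ((hi1.add ((hi h _).const_mul _)).const_mul _ |>.const_mul _) hpt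
    _ = 2 ^ p * (2 ^ (2 * p - 1) * (((∫ t, t ^ (2 * (2 * p)) ∂(sphereLaw d)) +
          ∫ t, (g.eval t) ^ (2 * (2 * p)) ∂(sphereLaw d)) / 2 +
          B ^ p * ∫ t, (h.eval t) ^ (2 * p) ∂(sphereLaw d))) := by
        rw [integral_const_mul, integral_const_mul, integral_add hi1 ((hi h _).const_mul _), integral_div,
          integral_add (hiX _) (hi g _), integral_const_mul]
    _ ≤ _ := by gcongr

/-- The moments of the normalized Gegenbauer polynomials are bounded uniformly in `d`. -/
lemma exists_gegenbauer_moment_le (k : ℕ) : ∀ p : ℕ, ∃ C : ℝ, ∀ d : ℕ, 2 ≤ d →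
    ∫ t, ((gegenbauer d k).eval t) ^ (2 * p) ∂(sphereLaw d) ≤ C := by
  have h0 : ∀ p : ℕ, ∃ C : ℝ, ∀ d : ℕ, 2 ≤ d →
      ∫ t, ((gegenbauer d 0).eval t) ^ (2 * p) ∂(sphereLaw d) ≤ C := fun p =>
    ⟨1, fun d hd => by
      have := isProbabilityMeasure_sphereLaw (one_le_two.trans hd)
      simp [gegenbauer_zero hd]⟩
  suffices (∀ p : ℕ, ∃ C : ℝ, ∀ d : ℕ, 2 ≤ d →
      ∫ t, ((gegenbauer d k).eval t) ^ (2 * p) ∂(sphereLaw d) ≤ C) ∧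
      ∀ p : ℕ, ∃ C : ℝ, ∀ d : ℕ, 2 ≤ d →
      ∫ t, ((gegenbauer d (k + 1)).eval t) ^ (2 * p) ∂(sphereLaw d) ≤ C from this.1
  induction k with
  | zero =>
    refine ⟨h0, fun p => ?_⟩
    obtain ⟨C₁, hC₁⟩ := h0 (2 * p)
    obtain ⟨C₂, hC₂⟩ := h0 p
    exact ⟨_, fun d hd => moment_le_of_recurrence (one_le_two.trans hd) p
      -- In degree one the recurrence has no third term; `h` is a dummy.
      (h := gegenbauer d 0) (b := 0) (B := 0)
      (by rw [X_mul_gegenbauer_zero hd]; simp) (recCoeff_sq_bounds hd 0).1 (by simp)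
      (hC₁ d hd) (hC₂ d hd)⟩
  | succ k ih =>
    refine ⟨ih.2, fun p => ?_⟩
    obtain ⟨C₁, hC₁⟩ := ih.2 (2 * p)
    obtain ⟨C₂, hC₂⟩ := ih.1 p
    exact ⟨_, fun d hd => moment_le_of_recurrence (one_le_two.trans hd) p
      (X_mul_gegenbauer hd k) (recCoeff_sq_bounds hd _).1 (recCoeff_sq_bounds hd _).2
      (hC₁ d hd) (hC₂ d hd)⟩

end NormalizationConstants

/-! ### Convolution of zonal polynomials. -/

section Reproducing

variable {d : ℕ}

lemma integrable_prod_unifSphere (hd : 1 ≤ d)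
    {F : EuclideanSpace ℝ (Fin d) × EuclideanSpace ℝ (Fin d) → ℝ} (hF : Continuous F) :
    Integrable F ((unifSphere d).prod (unifSphere d)) := by
  have := isProbabilityMeasure_unifSphere hd
  rw [← Measure.restrict_eq_self_of_ae_mem (μ := (unifSphere d).prod (unifSphere d))
    (s := Metric.sphere (0 : EuclideanSpace ℝ (Fin d)) 1 ×ˢ
      Metric.sphere (0 : EuclideanSpace ℝ (Fin d)) 1)]
  · exact hF.continuousOn.integrableOn_compact ((isCompact_sphere _ _).prod (isCompact_sphere _ _))
  · have h := ae_norm_eq_one_unifSphere d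
    filter_upwards [Measure.quasiMeasurePreserving_fst.ae h,
      Measure.quasiMeasurePreserving_snd.ae h] with x hx hx'
    exact ⟨by simpa using hx, by simpa using hx'⟩

/-- This makes the coefficients `I i` of the convolution below independent of the points. -/
lemma integral_orthonormal_pair {y u y' u' : EuclideanSpace ℝ (Fin d)} (hy : ‖y‖ = 1)
    (hu : ‖u‖ = 1) (hyu : inner ℝ y u = (0 : ℝ)) (hy' : ‖y'‖ = 1) (hu' : ‖u'‖ = 1)
    (hyu' : inner ℝ y' u' = (0 : ℝ)) (F : ℝ → ℝ → ℝ) :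
    ∫ x, F (inner ℝ x y) (inner ℝ x u) ∂(unifSphere d) =
      ∫ x, F (inner ℝ x y') (inner ℝ x u') ∂(unifSphere d) := by
  have hon (v w : EuclideanSpace ℝ (Fin d)) (hv : ‖v‖ = 1) (hw : ‖w‖ = 1)
      (hvw : inner ℝ v w = (0 : ℝ)) : Orthonormal ℝ ![v, w] := by
    refine ⟨fun i => ?_, fun i j hij => ?_⟩
    · fin_cases i <;> simp [hv, hw]
    · fin_cases i <;> fin_cases j <;> simp_all [real_inner_comm]
  obtain ⟨T, hT⟩ := exists_isometry_of_orthonormal (hon y u hy hu hyu) (hon y' u' hy' hu' hyu')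
  have h0 : T y = y' := hT 0
  have h1 : T u = u' := hT 1
  rw [← integral_unifSphere_comp_isometry d T (fun x => F (inner ℝ x y') (inner ℝ x u'))]
  simp [← h0, ← h1]

lemma exists_orthonormal_decomposition (hd : 2 ≤ d) {y z : EuclideanSpace ℝ (Fin d)}
    (hy : ‖y‖ = 1) (hz : ‖z‖ = 1) :
    ∃ (u : EuclideanSpace ℝ (Fin d)) (s : ℝ), ‖u‖ = 1 ∧ inner ℝ y u = (0 : ℝ) ∧
      z = (inner ℝ y z : ℝ) • y + s • u ∧ s ^ 2 = 1 - (inner ℝ y z : ℝ) ^ 2 := by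
  have hyy : inner ℝ y y = (1 : ℝ) := by rw [real_inner_self_eq_norm_sq, hy]; norm_num
  set w := z - (inner ℝ y z : ℝ) • y with hw
  have hyw : inner ℝ y w = (0 : ℝ) := by
    rw [hw, inner_sub_right, inner_smul_right, hyy]
    ring
  have hwn : ‖w‖ ^ 2 = 1 - (inner ℝ y z : ℝ) ^ 2 := by
    rw [hw, norm_sub_sq_real, hz, norm_smul, hy, inner_smul_right, real_inner_comm,
      Real.norm_eq_abs, mul_one, sq_abs]
    ring
  -- If `z` is a multiple of `y`, then `s = 0` and any unit vector orthogonal to `y` serves as `u`;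
  -- one exists as `d ≥ 2`.
  by_cases h0 : w = 0
  · obtain ⟨y₀, u₀, hy₀, hu₀, hyu₀⟩ := exists_orthonormal_pair hd
    obtain ⟨T, hT⟩ := exists_isometry_of_norm_eq_one hy₀ hy
    refine ⟨T u₀, 0, by simpa using hu₀, by rw [← hT]; simpa using hyu₀, ?_, ?_⟩
    · rw [zero_smul, add_zero]
      exact sub_eq_zero.1 h0
    · rw [← hwn, h0]
      simp
  · refine ⟨‖w‖⁻¹ • w, ‖w‖, ?_, ?_, ?_, hwn⟩
    · rw [norm_smul, norm_inv, norm_norm, inv_mul_cancel₀ (norm_ne_zero_iff.2 h0)]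
    · rw [inner_smul_right, hyw, mul_zero]
    · rw [smul_smul, mul_inv_cancel₀ (norm_ne_zero_iff.2 h0), one_smul, hw]
      abel

lemma exists_polynomial_convolution_pow (hd : 2 ≤ d) (f : Polynomial ℝ) (j : ℕ) :
    ∃ G : Polynomial ℝ, G.degree < ((j + 1 : ℕ) : WithBot ℕ) ∧
      ∀ y z : EuclideanSpace ℝ (Fin d), ‖y‖ = 1 → ‖z‖ = 1 →
      ∫ x, f.eval (√(d : ℝ) * inner ℝ x y) * (√(d : ℝ) * inner ℝ x z) ^ j ∂(unifSphere d) =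
        G.eval (√(d : ℝ) * inner ℝ y z) := by
  have hd1 : 1 ≤ d := one_le_two.trans hd
  have hs : √(d : ℝ) ≠ 0 := (Real.sqrt_pos.2 (by positivity)).ne'
  obtain ⟨y₀, u₀, hy₀, hu₀, hyu₀⟩ := exists_orthonormal_pair hd
  let I : ℕ → ℝ := fun i => ∫ x, f.eval (√(d : ℝ) * inner ℝ x y₀) *
    ((inner ℝ x y₀ : ℝ) ^ (j - i) * (inner ℝ x u₀ : ℝ) ^ i) ∂(unifSphere d)
  have hI : ∀ (i : ℕ) (y u : EuclideanSpace ℝ (Fin d)), ‖y‖ = 1 → ‖u‖ = 1 →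
      inner ℝ y u = (0 : ℝ) → ∫ x, f.eval (√(d : ℝ) * inner ℝ x y) *
        ((inner ℝ x y : ℝ) ^ (j - i) * (inner ℝ x u : ℝ) ^ i) ∂(unifSphere d) = I i :=
    fun i y u hy hu hyu => integral_orthonormal_pair hy hu hyu hy₀ hu₀ hyu₀
      (fun a b => f.eval (√(d : ℝ) * a) * (a ^ (j - i) * b ^ i))
  have hodd : ∀ i, Odd i → I i = 0 := by
    intro i hi
    have h := hI i y₀ (-u₀) hy₀ (by simpa using hu₀) (by simpa using hyu₀)
    simp only [inner_neg_right, hi.neg_pow, mul_neg, integral_neg] at h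
    have : -I i = I i := h
    linarith
  -- With `z = c y + s u`, the `i`-th binomial term carries `s ^ i c ^ (j-i)`. Odd `i` integrate to
  -- zero under `u ↦ -u`, and for even `i` the power `s ^ i = (1 - c²) ^ (i/2)` is a polynomial in
  -- `c`.
  let g : ℕ → Polynomial ℝ := fun i => Polynomial.C (√(d : ℝ) ^ j * (j.choose i) * I i) *
    ((1 - Polynomial.C ((d : ℝ)⁻¹) * Polynomial.X ^ 2) ^ (i / 2) *
      (Polynomial.C ((√(d : ℝ))⁻¹) * Polynomial.X) ^ (j - i))
  refine ⟨∑ i ∈ Finset.range (j + 1), g i, ?_, fun y z hy hz => ?_⟩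
  · refine (Polynomial.degree_sum_le _ _).trans_lt
      ((Finset.sup_lt_iff (WithBot.bot_lt_coe _)).2 fun i hi => ?_)
    rw [Finset.mem_range] at hi
    refine lt_of_le_of_lt (Polynomial.degree_le_of_natDegree_le (n := j) ?_)
      (Nat.cast_lt.2 j.lt_succ_self)
    have : (g i).natDegree ≤ 0 + ((i / 2) * 2 + (j - i) * 1) := by
      refine Polynomial.natDegree_mul_le_of_le (Polynomial.natDegree_C _).le
        (Polynomial.natDegree_mul_le_of_le (Polynomial.natDegree_pow_le_of_le _ ?_)
          (Polynomial.natDegree_pow_le_of_le _ ?_))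
      · compute_degree
      · compute_degree
    omega
  · obtain ⟨u, s, hu, hyu, hzd, hs2⟩ := exists_orthonormal_decomposition hd hy hz
    set c : ℝ := inner ℝ y z with hc
    have hexp : ∀ x : EuclideanSpace ℝ (Fin d),
        f.eval (√(d : ℝ) * inner ℝ x y) * (√(d : ℝ) * inner ℝ x z) ^ j =
        ∑ i ∈ Finset.range (j + 1), (√(d : ℝ) ^ j * (j.choose i) * (s ^ i * c ^ (j - i))) *
          (f.eval (√(d : ℝ) * inner ℝ x y) *
            ((inner ℝ x y : ℝ) ^ (j - i) * (inner ℝ x u : ℝ) ^ i)) := by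
      intro x
      have : (inner ℝ x z : ℝ) = s * inner ℝ x u + c * inner ℝ x y := by
        rw [hzd, inner_add_right, inner_smul_right, inner_smul_right]
        ring
      rw [this, mul_pow, add_pow, Finset.mul_sum, Finset.mul_sum]
      refine Finset.sum_congr rfl fun i _ => ?_
      rw [mul_pow, mul_pow]
      ring
    simp only [hexp]
    rw [integral_finsetSum, Polynomial.eval_finsetSum]
    · refine Finset.sum_congr rfl fun i _ => ?_
      rw [integral_const_mul, hI i y u hy hu hyu]
      rcases Nat.even_or_odd i with h | h
      · obtain ⟨r, hr⟩ := h.two_dvd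
        have hdd : (d : ℝ)⁻¹ * (√(d : ℝ) * c) ^ 2 = c ^ 2 := by
          rw [mul_pow, Real.sq_sqrt (by positivity)]
          field_simp
        have hdc : (√(d : ℝ))⁻¹ * (√(d : ℝ) * c) = c := by field_simp
        simp only [g, Polynomial.eval_mul, Polynomial.eval_C, Polynomial.eval_pow,
          Polynomial.eval_sub, Polynomial.eval_one, Polynomial.eval_X, hdd, hdc, ← hs2]
        rw [hr, Nat.mul_div_cancel_left _ two_pos, pow_mul]
        ring
      · simp [g, hodd i h]
    · exact fun i _ => integrable_unifSphere hd1 (by fun_prop)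

/-- The convolution of two zonal polynomials is a zonal polynomial. -/
lemma exists_polynomial_convolution (hd : 2 ≤ d) (f g : Polynomial ℝ) {m : ℕ}
    (hg : g.degree < m) :
    ∃ G : Polynomial ℝ, G.degree < m ∧
      ∀ y z : EuclideanSpace ℝ (Fin d), ‖y‖ = 1 → ‖z‖ = 1 →
      ∫ x, f.eval (√(d : ℝ) * inner ℝ x y) * g.eval (√(d : ℝ) * inner ℝ x z) ∂(unifSphere d) =
        G.eval (√(d : ℝ) * inner ℝ y z) := by
  choose G hG hGe using exists_polynomial_convolution_pow hd f
  refine ⟨∑ i ∈ Finset.range m, Polynomial.C (g.coeff i) * G i, ?_, fun y z hy hz => ?_⟩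
  · refine (Polynomial.degree_sum_le _ _).trans_lt
      ((Finset.sup_lt_iff (WithBot.bot_lt_coe _)).2 fun i hi => ?_)
    rw [← Polynomial.smul_eq_C_mul]
    refine (Polynomial.degree_smul_le _ _).trans_lt ((hG i).trans_le ?_)
    exact Nat.cast_le.2 (Finset.mem_range.1 hi)
  · have hexp : ∀ x : EuclideanSpace ℝ (Fin d),
        f.eval (√(d : ℝ) * inner ℝ x y) * g.eval (√(d : ℝ) * inner ℝ x z) =
        ∑ i ∈ Finset.range m, g.coeff i *
          (f.eval (√(d : ℝ) * inner ℝ x y) * (√(d : ℝ) * inner ℝ x z) ^ i) := by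
      intro x
      have hgs : g = ∑ i ∈ Finset.range m, Polynomial.C (g.coeff i) * Polynomial.X ^ i := by
        ext n
        simp only [Polynomial.finsetSum_coeff, Polynomial.coeff_C_mul_X_pow]
        rw [Finset.sum_ite_eq]
        split_ifs with h
        · rfl
        · exact Polynomial.degree_lt_iff_coeff_zero _ _ |>.1 hg n (by simpa using h)
      conv_lhs => rw [hgs]
      rw [Polynomial.eval_finsetSum, Finset.mul_sum]
      refine Finset.sum_congr rfl fun i _ => ?_
      simp only [Polynomial.eval_mul, Polynomial.eval_C, Polynomial.eval_pow, Polynomial.eval_X]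
      ring
    simp only [hexp]
    rw [integral_finsetSum, Polynomial.eval_finsetSum]
    · refine Finset.sum_congr rfl fun i _ => ?_
      rw [integral_const_mul, hGe i y z hy hz, Polynomial.eval_mul, Polynomial.eval_C]
    · exact fun i _ => integrable_unifSphere (one_le_two.trans hd) (by fun_prop)

/-- The reproducing property of the zonal kernels given by Gegenbauer polynomials. -/
lemma integral_gegenbauer_mul_gegenbauer (hd : 2 ≤ d) (k : ℕ) {y z : EuclideanSpace ℝ (Fin d)}
    (hy : ‖y‖ = 1) (hz : ‖z‖ = 1) :
    ∫ x, (gegenbauer d k).eval (√(d : ℝ) * inner ℝ x y) *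
      (gegenbauer d k).eval (√(d : ℝ) * inner ℝ x z) ∂(unifSphere d) =
      (gegenbauerEnd d k)⁻¹ * (gegenbauer d k).eval (√(d : ℝ) * inner ℝ y z) := by
  have hd1 : 1 ≤ d := one_le_two.trans hd
  have := isProbabilityMeasure_unifSphere hd1
  have hlt : ∀ j : ℕ, (gegenbauer d j).degree < ((j + 1 : ℕ) : WithBot ℕ) := fun j => by
    rw [degree_gegenbauer hd]
    exact Nat.cast_lt.2 j.lt_succ_self
  obtain ⟨G, hG, hGe⟩ := exists_polynomial_convolution hd (gegenbauer d k) (gegenbauer d k) (hlt k)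
  -- By Fubini the convolution moves onto `q_j`, giving `H` of degree at most `j`, which is
  -- orthogonal to `q_k`. Hence `G` is a multiple of `q_k`, and setting `z = y` identifies the
  -- factor.
  have horth : ∀ j < k, sphereExp d hd1 (G * gegenbauer d j) = 0 := by
    intro j hj
    obtain ⟨H, hH, hHe⟩ :=
      exists_polynomial_convolution hd (gegenbauer d k) (gegenbauer d j) (hlt j)
    rw [sphereExp_eq_integral_unifSphere hd1 hy]
    calc ∫ w, (G * gegenbauer d j).eval (√(d : ℝ) * inner ℝ w y) ∂(unifSphere d)
        = ∫ w, ∫ x, (gegenbauer d k).eval (√(d : ℝ) * inner ℝ x w) *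
            (gegenbauer d k).eval (√(d : ℝ) * inner ℝ x y) *
            (gegenbauer d j).eval (√(d : ℝ) * inner ℝ w y) ∂(unifSphere d) ∂(unifSphere d) := by
          refine integral_congr_ae ?_
          filter_upwards [ae_norm_eq_one_unifSphere d] with w hw
          rw [integral_mul_const, hGe w y hw hy, Polynomial.eval_mul]
      _ = ∫ x, ∫ w, (gegenbauer d k).eval (√(d : ℝ) * inner ℝ x w) *
            (gegenbauer d k).eval (√(d : ℝ) * inner ℝ x y) *
            (gegenbauer d j).eval (√(d : ℝ) * inner ℝ w y) ∂(unifSphere d) ∂(unifSphere d) := by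
          refine integral_integral_swap (integrable_prod_unifSphere hd1 ?_)
          simp only [Function.uncurry_def]
          fun_prop
      _ = ∫ x, (H * gegenbauer d k).eval (√(d : ℝ) * inner ℝ x y) ∂(unifSphere d) := by
          refine integral_congr_ae ?_
          filter_upwards [ae_norm_eq_one_unifSphere d] with x hx
          rw [Polynomial.eval_mul, ← hHe x y hx hy, ← integral_mul_const]
          refine integral_congr_ae (Eventually.of_forall fun w => ?_)
          simp only [real_inner_comm w x]
          ring
      _ = 0 := by
          rw [← sphereExp_eq_integral_unifSphere hd1 hy]
          exact sphereExp_mul_gegenbauer_of_degree_lt hd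
            (hH.trans_le (Nat.cast_le.2 (Nat.succ_le_of_lt hj)))
  have hGk := eq_sum_gegenbauer hd hG
  rw [Finset.sum_range_succ, Finset.sum_eq_zero, zero_add] at hGk
  · set c := sphereExp d hd1 (G * gegenbauer d k)
    have hyy : inner ℝ y y = (1 : ℝ) := by rw [real_inner_self_eq_norm_sq, hy]; norm_num
    have h1 := hGe y y hy hy
    simp only [← sq] at h1
    rw [hyy, mul_one, hGk, Polynomial.eval_mul, Polynomial.eval_C] at h1
    have h2 := sphereExp_gegenbauer_sq hd k
    rw [sphereExp_eq_integral_unifSphere hd1 hy] at h2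
    simp only [Polynomial.eval_pow] at h2
    rw [h2] at h1
    rw [hGe y z hy hz, hGk, Polynomial.eval_mul, Polynomial.eval_C,
      eq_inv_of_mul_eq_one_left (h1.symm : c * gegenbauerEnd d k = 1)]
    rfl
  · intro i hi
    rw [horth i (Finset.mem_range.1 hi)]
    simp

end Reproducing

/-! ### Walks and their weights. -/

section Walks

variable {ι : Type*}

/-- The steps of the walk from `i` to `j` through the vertices of a list. -/
def walkSteps (i : ι) : List ι → ι → List (ι × ι)
  | [], j => [(i, j)]
  | a :: l, j => (i, a) :: walkSteps a l j

/-- The product of the weights `A` along the walk from `i` to `j` through the vertices of a list. -/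
def walkProd (A : ι → ι → ℝ) (i : ι) (l : List ι) (j : ι) : ℝ :=
  ((walkSteps i l j).map fun p => A p.1 p.2).prod

/-- The product of the weights `A` along the closed walk through the vertices of a list. -/
def cycleProd (A : ι → ι → ℝ) : List ι → ℝ
  | [] => 1
  | a :: l => walkProd A a l a

lemma walkProd_nil (A : ι → ι → ℝ) (i j : ι) : walkProd A i [] j = A i j := by
  simp [walkProd, walkSteps]

lemma walkProd_cons (A : ι → ι → ℝ) (i a j : ι) (l : List ι) :
    walkProd A i (a :: l) j = A i a * walkProd A a l j := by
  simp [walkProd, walkSteps]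

lemma length_walkSteps (i j : ι) (l : List ι) : (walkSteps i l j).length = l.length + 1 := by
  induction l generalizing i with
  | nil => rfl
  | cons a l ih => simp [walkSteps, ih]

lemma walkProd_append (A : ι → ι → ℝ) (i a j : ι) (l l' : List ι) :
    walkProd A i (l ++ a :: l') j = walkProd A i l a * walkProd A a l' j := by
  induction l generalizing i with
  | nil => rw [List.nil_append, walkProd_cons, walkProd_nil]
  | cons b l ih => rw [List.cons_append, walkProd_cons, walkProd_cons, ih, mul_assoc]

lemma cycleProd_append_comm (A : ι → ι → ℝ) (l l' : List ι) :
    cycleProd A (l ++ l') = cycleProd A (l' ++ l) := by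
  rcases l with _ | ⟨a, l⟩ <;> rcases l' with _ | ⟨b, l'⟩
  · rfl
  · simp
  · simp
  · rw [List.cons_append, List.cons_append, cycleProd, cycleProd, walkProd_append, walkProd_append,
      mul_comm]

/-- One of the two equal endpoints of the loop is dropped; the visited set is unchanged, and the
same shorter walk works for all weights. -/
lemma exists_erase_loop [DecidableEq ι] {i j c : ι} {l : List ι} (hl : l ≠ [])
    (h : (c, c) ∈ walkSteps i l j) :
    ∃ l' : List ι, l.length = l'.length + 1 ∧
      insert j (insert i l'.toFinset) = insert j (insert i l.toFinset) ∧
      ∀ A : ι → ι → ℝ, walkProd A i l j = A c c * walkProd A i l' j := by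
  induction l generalizing i with
  | nil => exact absurd rfl hl
  | cons a t ih =>
    rw [walkSteps, List.mem_cons] at h
    rcases h with h | h
    · obtain ⟨rfl, rfl⟩ := Prod.mk.inj h
      exact ⟨t, rfl, by simp, fun A => walkProd_cons _ _ _ _ _⟩
    · rcases t with _ | ⟨b, t⟩
      · rw [walkSteps, List.mem_singleton] at h
        obtain ⟨rfl, rfl⟩ := Prod.mk.inj h
        exact ⟨[], rfl, by simp [Finset.pair_comm], fun A => by
          rw [walkProd_cons, walkProd_nil, walkProd_nil, mul_comm]⟩
      · obtain ⟨l', h1, h2, h3⟩ := ih (by simp) h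
        refine ⟨a :: l', by simp [h1], ?_, fun A => ?_⟩
        · rw [List.toFinset_cons, List.toFinset_cons, Finset.insert_comm j i,
            Finset.insert_comm j i, h2]
        · rw [walkProd_cons, h3, walkProd_cons]
          ring

/-- The product of the weights along a walk, without the closing step. -/
def openProd (A : ι → ι → ℝ) : ι → List ι → ℝ
  | _, [] => 1
  | c, a :: t => A c a * openProd A a t

lemma walkProd_eq_openProd_mul (A : ι → ι → ℝ) (c : ι) (t : List ι) (j : ι) :
    walkProd A c t j = openProd A c t * A ((c :: t).getLast (by simp)) j := by
  induction t generalizing c with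
  | nil => simp [walkProd_nil, openProd]
  | cons a t ih =>
    rw [walkProd_cons, ih, openProd, mul_assoc, List.getLast_cons (List.cons_ne_nil a t)]

lemma openProd_congr {A B : ι → ι → ℝ} {c : ι} {t : List ι}
    (h : ∀ i ∈ c :: t, ∀ j ∈ c :: t, A i j = B i j) : openProd A c t = openProd B c t := by
  induction t generalizing c with
  | nil => rfl
  | cons a t ih =>
    rw [openProd, openProd, h c (by simp) a (by simp),
      ih fun i hi j hj => h i (List.mem_cons_of_mem _ hi) j (List.mem_cons_of_mem _ hj)]

lemma continuous_walkProd {X : Type*} [TopologicalSpace X] {A : X → ι → ι → ℝ}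
    (hA : ∀ i j, Continuous fun x => A x i j) (i : ι) (l : List ι) (j : ι) :
    Continuous fun x => walkProd (A x) i l j := by
  induction l generalizing i with
  | nil => simpa only [walkProd_nil] using hA i j
  | cons a l ih =>
    simp only [walkProd_cons]
    exact (hA i a).mul (ih a)

lemma continuous_cycleProd {X : Type*} [TopologicalSpace X] {A : X → ι → ι → ℝ}
    (hA : ∀ i j, Continuous fun x => A x i j) (l : List ι) :
    Continuous fun x => cycleProd (A x) l := by
  rcases l with _ | ⟨a, l⟩
  · exact continuous_const
  · exact continuous_walkProd hA a l a

end Walks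

/-! ### AM-GM with padding. -/

section AMGM

/-- Each `z i ^ m` gets weight `1 / m`; the missing weight sits on the constant `1`, carried by the
extra index `none`. -/
lemma prod_le_sum_pow_div {ι : Type*} (s : Finset ι) (z : ι → ℝ) (hz : ∀ i ∈ s, 0 ≤ z i) {m : ℕ}
    (hm : 0 < m) (hs : s.card ≤ m) :
    ∏ i ∈ s, z i ≤ (∑ i ∈ s, z i ^ m + (m - s.card)) / m := by
  have hm' : (0 : ℝ) < m := by exact_mod_cast hm
  have hs' : (s.card : ℝ) ≤ m := by exact_mod_cast hs
  have h := Real.geom_mean_le_arith_mean_weighted (Finset.insertNone s)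
    (fun o => o.elim ((m - s.card) / m : ℝ) fun _ => 1 / m)
    (fun o => o.elim 1 fun i => z i ^ m) ?_ ?_ ?_
  · rw [Finset.prod_insertNone, Finset.sum_insertNone] at h
    simp only [Option.elim_none, Option.elim_some, Real.one_rpow, one_mul, mul_one] at h
    have e : ∏ i ∈ s, (z i ^ m) ^ (1 / m : ℝ) = ∏ i ∈ s, z i :=
      Finset.prod_congr rfl fun i hi => by
        rw [one_div, Real.pow_rpow_inv_natCast (hz i hi) hm.ne']
    rw [e, ← Finset.mul_sum] at h
    refine h.trans_eq ?_
    ring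
  · rintro (_ | i) hi
    · exact div_nonneg (by linarith) hm'.le
    · exact div_nonneg zero_le_one hm'.le
  · rw [Finset.sum_insertNone]
    simp only [Option.elim_none, Option.elim_some, Finset.sum_const, nsmul_eq_mul]
    field_simp
    ring
  · rintro (_ | i) hi
    · exact zero_le_one
    · exact pow_nonneg (hz i (Finset.some_mem_insertNone.1 hi)) _

end AMGM

/-! ### Independent uniform points and resampling of one of them. -/

section SphereProduct

variable {d : ℕ} {ι : Type*} [Fintype ι]

/-- The law of a family of independent uniform points on the sphere. -/
noncomputable def unifSpherePi (d : ℕ) (ι : Type*) [Fintype ι] :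
    Measure (ι → EuclideanSpace ℝ (Fin d)) :=
  Measure.pi fun _ => unifSphere d

lemma isProbabilityMeasure_unifSpherePi (hd : 1 ≤ d) :
    IsProbabilityMeasure (unifSpherePi d ι) := by
  have := isProbabilityMeasure_unifSphere hd
  unfold unifSpherePi
  infer_instance

lemma ae_norm_eq_one_unifSpherePi (hd : 1 ≤ d) :
    ∀ᵐ x ∂(unifSpherePi d ι), ∀ i, ‖x i‖ = 1 := by
  have := isProbabilityMeasure_unifSphere hd
  rw [ae_all_iff]
  intro i
  exact (Measure.quasiMeasurePreserving_eval (fun _ : ι => unifSphere d) i).ae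
    (ae_norm_eq_one_unifSphere d)

lemma integrable_unifSpherePi (hd : 1 ≤ d) {F : (ι → EuclideanSpace ℝ (Fin d)) → ℝ}
    (hF : Continuous F) : Integrable F (unifSpherePi d ι) := by
  have := isProbabilityMeasure_unifSpherePi (ι := ι) hd
  rw [← Measure.restrict_eq_self_of_ae_mem (μ := unifSpherePi d ι)
    (s := Set.univ.pi fun _ => Metric.sphere (0 : EuclideanSpace ℝ (Fin d)) 1)]
  · exact hF.continuousOn.integrableOn_compact (isCompact_univ_pi fun _ => isCompact_sphere _ _)
  · filter_upwards [ae_norm_eq_one_unifSpherePi hd] with x hx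
    exact fun i _ => by simpa using hx i

/-- Resampling one coordinate. -/
lemma measurePreserving_update [DecidableEq ι] (hd : 1 ≤ d) (b : ι) :
    MeasurePreserving (fun p : (ι → EuclideanSpace ℝ (Fin d)) × EuclideanSpace ℝ (Fin d) =>
      Function.update p.1 b p.2) ((unifSpherePi d ι).prod (unifSphere d)) (unifSpherePi d ι) := by
  have := isProbabilityMeasure_unifSphere hd
  have hm : Measurable (fun p : (ι → EuclideanSpace ℝ (Fin d)) × EuclideanSpace ℝ (Fin d) =>
      Function.update p.1 b p.2) := by fun_prop
  refine ⟨hm, ?_⟩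
  symm
  refine Measure.pi_eq fun s hs => ?_
  rw [Measure.map_apply hm (MeasurableSet.univ_pi hs)]
  have : (fun p : (ι → EuclideanSpace ℝ (Fin d)) × EuclideanSpace ℝ (Fin d) =>
      Function.update p.1 b p.2) ⁻¹' Set.univ.pi s =
      (Set.univ.pi (Function.update s b Set.univ)) ×ˢ s b := by
    ext ⟨x, y⟩
    simp only [Set.mem_preimage, Set.mem_univ_pi, Set.mem_prod]
    constructor
    · intro h
      refine ⟨fun i => ?_, by simpa using h b⟩
      by_cases hi : i = b
      · subst hi; simp
      · simpa [hi] using h i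
    · rintro ⟨h1, h2⟩ i
      by_cases hi : i = b
      · subst hi; simpa using h2
      · simpa [hi] using h1 i
  rw [this, Measure.prod_prod, unifSpherePi, Measure.pi_pi,
    ← Finset.prod_erase_mul _ _ (Finset.mem_univ b),
    ← Finset.prod_erase_mul _ _ (Finset.mem_univ b)]
  simp only [Function.update_self, measure_univ, mul_one]
  congr 1
  exact Finset.prod_congr rfl fun i hi => by rw [Function.update_of_ne (Finset.ne_of_mem_erase hi)]

lemma integral_unifSpherePi_update [DecidableEq ι] (hd : 1 ≤ d) (b : ι)
    {F : (ι → EuclideanSpace ℝ (Fin d)) → ℝ} (hF : Continuous F) :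
    ∫ x, F x ∂(unifSpherePi d ι) =
      ∫ x, ∫ y, F (Function.update x b y) ∂(unifSphere d) ∂(unifSpherePi d ι) := by
  have := isProbabilityMeasure_unifSphere hd
  have := isProbabilityMeasure_unifSpherePi (ι := ι) hd
  have h := measurePreserving_update (ι := ι) hd b
  conv_lhs => rw [← h.map_eq]
  rw [integral_map h.measurable.aemeasurable hF.aestronglyMeasurable]
  refine integral_prod _ ?_
  exact h.integrable_comp_of_integrable (integrable_unifSpherePi hd hF)

end SphereProduct

/-! ### The expected weight of a closed walk. -/

section CycleBound

variable {d : ℕ} {ι : Type*}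

/-- The zonal kernel of the `k`-th Gegenbauer polynomial at a family of points. -/
noncomputable def zonalKernel (d k : ℕ) (x : ι → EuclideanSpace ℝ (Fin d)) (i j : ι) : ℝ :=
  (gegenbauer d k).eval (√(d : ℝ) * inner ℝ (x i) (x j))

/-- The moment of order `m` of the `k`-th Gegenbauer polynomial under `sphereLaw d`. -/
noncomputable def gegenbauerMoment (d k m : ℕ) : ℝ :=
  ∫ t, ((gegenbauer d k).eval t) ^ m ∂(sphereLaw d)

lemma continuous_zonalKernel (k : ℕ) (i j : ι) :
    Continuous fun x : ι → EuclideanSpace ℝ (Fin d) => zonalKernel d k x i j := by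
  unfold zonalKernel
  fun_prop

lemma zonalKernel_self {k : ℕ} {x : ι → EuclideanSpace ℝ (Fin d)} {i : ι} (h : ‖x i‖ = 1) :
    zonalKernel d k x i i = gegenbauerEnd d k := by
  rw [zonalKernel, real_inner_self_eq_norm_sq, h, one_pow, mul_one, gegenbauerEnd]

/-- Bernoulli's inequality for `q_k²`, which has mean one. -/
lemma one_le_gegenbauerMoment (hd : 2 ≤ d) (k p : ℕ) : 1 ≤ gegenbauerMoment d k (2 * p) := by
  have hd1 : 1 ≤ d := one_le_two.trans hd
  have := isProbabilityMeasure_sphereLaw hd1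
  have hsq : ∫ t, ((gegenbauer d k).eval t) ^ 2 ∂(sphereLaw d) = 1 := by
    have := sphereExp_gegenbauer_sq hd k
    rw [sphereExp_apply] at this
    simpa only [Polynomial.eval_pow] using this
  have hi : ∀ m : ℕ, Integrable (fun t => ((gegenbauer d k).eval t) ^ m) (sphereLaw d) :=
    fun m => integrable_sphereLaw hd1 ((gegenbauer d k).continuous.pow m)
  have hi2 : Integrable (fun t => (p : ℝ) * (((gegenbauer d k).eval t) ^ 2 - 1)) (sphereLaw d) :=
    ((hi 2).sub (integrable_const 1)).const_mul _
  calc (1 : ℝ) = ∫ t, (1 + (p : ℝ) * (((gegenbauer d k).eval t) ^ 2 - 1)) ∂(sphereLaw d) := by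
        rw [integral_add (integrable_const _) hi2, integral_const_mul,
          integral_sub (hi 2) (integrable_const _), hsq]
        simp
    _ ≤ gegenbauerMoment d k (2 * p) := by
        refine integral_mono ((integrable_const _).add hi2) (hi _) fun t => ?_
        have := one_add_mul_le_pow (a := ((gegenbauer d k).eval t) ^ 2 - 1)
          (by nlinarith [sq_nonneg ((gegenbauer d k).eval t)]) p
        rw [add_sub_cancel, ← pow_mul] at this
        exact this

lemma two_mul_card_toFinset_le [DecidableEq ι] {l : List ι} (h : ∀ a ∈ l, 2 ≤ l.count a) :
    2 * l.toFinset.card ≤ l.length := by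
  rw [← l.sum_toFinset_count_eq_length, mul_comm]
  exact Finset.card_nsmul_le_sum _ _ _ fun a ha => h a (List.mem_toFinset.1 ha)

variable [Fintype ι] [DecidableEq ι]

lemma integral_zonalKernel_pow (hd : 2 ≤ d) (k m : ℕ) {i j : ι} (hij : i ≠ j) :
    ∫ x, zonalKernel d k x i j ^ m ∂(unifSpherePi d ι) = gegenbauerMoment d k m := by
  have hd1 : 1 ≤ d := one_le_two.trans hd
  have := isProbabilityMeasure_unifSpherePi (ι := ι) hd1
  rw [integral_unifSpherePi_update hd1 i (F := fun x => zonalKernel d k x i j ^ m)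
    ((continuous_zonalKernel k i j).pow m)]
  have h : ∀ᵐ x ∂(unifSpherePi d ι), ∫ y, zonalKernel d k (Function.update x i y) i j ^ m
      ∂(unifSphere d) = gegenbauerMoment d k m := by
    filter_upwards [ae_norm_eq_one_unifSpherePi hd1] with x hx
    rw [gegenbauerMoment, integral_sphereLaw hd1 (hx j)
      (f := fun t => (gegenbauer d k).eval t ^ m) ((gegenbauer d k).continuous.pow m)]
    simp [zonalKernel, Function.update_of_ne hij.symm]
  rw [integral_congr_ae h]
  simp

/-- AM-GM over the steps, each of which has the same moment because its endpoints differ. Walks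
shorter than `2p` are padded by ones, absorbed as the moment is at least one. -/
lemma abs_integral_walkProd_le (hd : 2 ≤ d) (k : ℕ) {p : ℕ} (i j : ι) (l : List ι)
    (hl : l.length + 1 ≤ 2 * p) (hne : ∀ s ∈ walkSteps i l j, s.1 ≠ s.2) :
    |∫ x, walkProd (zonalKernel d k x) i l j ∂(unifSpherePi d ι)| ≤
      gegenbauerMoment d k (2 * p) := by
  have hd1 : 1 ≤ d := one_le_two.trans hd
  have := isProbabilityMeasure_unifSpherePi (ι := ι) hd1
  set S := walkSteps i l j with hS
  have hSl : S.length ≤ 2 * p := by rw [hS, length_walkSteps]; exact hl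
  have hp : 0 < 2 * p := by omega
  have hp' : (0 : ℝ) < (2 * p : ℕ) := by exact_mod_cast hp
  have hK : ∀ (s : ι × ι), Continuous fun x : ι → EuclideanSpace ℝ (Fin d) =>
      zonalKernel d k x s.1 s.2 := fun s => continuous_zonalKernel k _ _
  have hw : ∀ x : ι → EuclideanSpace ℝ (Fin d), |walkProd (zonalKernel d k x) i l j| ≤
      (∑ r : Fin S.length, zonalKernel d k x S[r].1 S[r].2 ^ (2 * p) +
        ((2 * p : ℕ) - S.length)) / (2 * p : ℕ) := by
    intro x
    have hprod : walkProd (zonalKernel d k x) i l j =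
        ∏ r : Fin S.length, zonalKernel d k x S[r].1 S[r].2 :=
      (Fin.prod_univ_fun_getElem S fun s => zonalKernel d k x s.1 s.2).symm
    rw [hprod, Finset.abs_prod]
    refine (prod_le_sum_pow_div Finset.univ _ (fun _ _ => abs_nonneg _) hp
      (by simpa using hSl)).trans_eq ?_
    simp only [Finset.card_univ, Fintype.card_fin, (even_two_mul p).pow_abs]
  have hi : ∀ r : Fin S.length, Integrable (fun x : ι → EuclideanSpace ℝ (Fin d) =>
      zonalKernel d k x S[r].1 S[r].2 ^ (2 * p)) (unifSpherePi d ι) :=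
    fun r => integrable_unifSpherePi hd1 ((hK _).pow _)
  have hi' := integrable_finsetSum Finset.univ fun r _ => hi r
  have hMr : ∀ r : Fin S.length, ∫ x, zonalKernel d k x S[r].1 S[r].2 ^ (2 * p)
      ∂(unifSpherePi d ι) = gegenbauerMoment d k (2 * p) :=
    fun r => integral_zonalKernel_pow hd k (2 * p) (hne S[r] (List.getElem_mem _))
  have hM := one_le_gegenbauerMoment hd k p
  calc |∫ x, walkProd (zonalKernel d k x) i l j ∂(unifSpherePi d ι)|
      ≤ ∫ x, |walkProd (zonalKernel d k x) i l j| ∂(unifSpherePi d ι) :=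
        abs_integral_le_integral_abs
    _ ≤ ∫ x, (∑ r : Fin S.length, zonalKernel d k x S[r].1 S[r].2 ^ (2 * p) +
        ((2 * p : ℕ) - S.length)) / (2 * p : ℕ) ∂(unifSpherePi d ι) :=
        integral_mono (integrable_unifSpherePi hd1
          (continuous_walkProd (fun a b => continuous_zonalKernel k a b) i l j).abs)
          ((hi'.add (integrable_const _)).div_const _) hw
    _ = (S.length * gegenbauerMoment d k (2 * p) + ((2 * p : ℕ) - S.length)) / (2 * p : ℕ) := by
        rw [integral_div, integral_add hi' (integrable_const _),
          integral_finsetSum _ fun r _ => hi r,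
          Finset.sum_congr rfl fun r _ => hMr r]
        simp
    _ ≤ gegenbauerMoment d k (2 * p) := by
        rw [div_le_iff₀ hp']
        have : (S.length : ℝ) ≤ (2 * p : ℕ) := by exact_mod_cast hSl
        nlinarith

/-- Integrating out a vertex that a closed walk visits once. -/
lemma integral_cycleProd_cons (hd : 2 ≤ d) (k : ℕ) {b c : ι} {t : List ι} (hb : b ∉ c :: t) :
    ∫ x, cycleProd (zonalKernel d k x) (b :: c :: t) ∂(unifSpherePi d ι) =
      (gegenbauerEnd d k)⁻¹ * ∫ x, cycleProd (zonalKernel d k x) (c :: t) ∂(unifSpherePi d ι) := by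
  have hd1 : 1 ≤ d := one_le_two.trans hd
  rw [integral_unifSpherePi_update hd1 b
    (continuous_cycleProd (fun a b => continuous_zonalKernel k a b) _), ← integral_const_mul]
  refine integral_congr_ae ?_
  filter_upwards [ae_norm_eq_one_unifSpherePi hd1] with x hx
  -- The two neighbours of `b` on the cycle are `c` and `e`; they may coincide, in which case the
  -- reproducing property produces a loop.
  set e := (c :: t).getLast (by simp) with he
  have hec : e ∈ c :: t := List.getLast_mem _
  have hbc : c ≠ b := fun h => hb (h ▸ List.mem_cons_self)
  have hbe : e ≠ b := fun h => hb (h ▸ hec)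
  have h : ∀ y, cycleProd (zonalKernel d k (Function.update x b y)) (b :: c :: t) =
      openProd (zonalKernel d k x) c t * ((gegenbauer d k).eval (√(d : ℝ) * inner ℝ y (x e)) *
        (gegenbauer d k).eval (√(d : ℝ) * inner ℝ y (x c))) := by
    intro y
    rw [cycleProd, walkProd_cons, walkProd_eq_openProd_mul, ← he,
      openProd_congr (B := zonalKernel d k x)]
    · simp only [zonalKernel, Function.update_self, Function.update_of_ne hbc,
        Function.update_of_ne hbe, real_inner_comm y]
      ring
    · intro i hi j hj
      have hib : i ≠ b := fun h => hb (h ▸ hi)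
      have hjb : j ≠ b := fun h => hb (h ▸ hj)
      simp only [zonalKernel, Function.update_of_ne hib, Function.update_of_ne hjb]
  simp only [h]
  rw [integral_const_mul, integral_gegenbauer_mul_gegenbauer hd k (hx e) (hx c), cycleProd,
    walkProd_eq_openProd_mul, ← he, zonalKernel]
  ring

lemma one_le_abs_gegenbauerEnd (hd : 2 ≤ d) (k : ℕ) : 1 ≤ |gegenbauerEnd d k| := by
  rw [abs_gegenbauerEnd hd, Real.one_le_sqrt]
  exact one_le_harmonicDim hd k

/-- A closed walk of length `L` with `V` distinct vertices has expected weight at most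
`N ^ (L / 2 + 1 - V)` times the moment of order `2 p`. -/
lemma abs_integral_cycleProd_mul_le (hd : 2 ≤ d) (k p : ℕ) (w : List ι) (hw0 : w ≠ [])
    (hwp : w.length ≤ 2 * p) :
    |∫ x, cycleProd (zonalKernel d k x) w ∂(unifSpherePi d ι)| *
      |gegenbauerEnd d k| ^ (2 * w.toFinset.card) ≤
      gegenbauerMoment d k (2 * p) * |gegenbauerEnd d k| ^ (w.length + 2) := by
  have hd1 : 1 ≤ d := one_le_two.trans hd
  have := isProbabilityMeasure_unifSpherePi (ι := ι) hd1
  have hs := one_le_abs_gegenbauerEnd hd k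
  have hs0 : 0 < |gegenbauerEnd d k| := one_pos.trans_le hs
  have hM := one_le_gegenbauerMoment hd k p
  have hM0 : 0 ≤ gegenbauerMoment d k (2 * p) := zero_le_one.trans hM
  -- Erasing a loop lowers the length only and gains `E`; removing a vertex visited once lowers
  -- length and vertex count by one and costs `E⁻¹`. Both preserve the inequality, written with
  -- powers of `|E| = √N` to avoid negative exponents.
  induction hL : w.length generalizing w with
  | zero => exact absurd (List.length_eq_zero_iff.1 hL) hw0
  | succ L ih =>
  obtain ⟨a, l, rfl⟩ := List.exists_cons_of_ne_nil hw0
  by_cases hloop : ∃ s ∈ walkSteps a l a, s.1 = s.2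
  · obtain ⟨⟨c, c'⟩, hcs, rfl : c = c'⟩ := hloop
    by_cases hl : l = []
    · subst hl
      have hL0 : L = 0 := by simpa using hL.symm
      have : ∫ x, cycleProd (zonalKernel d k x) [a] ∂(unifSpherePi d ι) = gegenbauerEnd d k := by
        have h : ∀ᵐ x ∂(unifSpherePi d ι), cycleProd (zonalKernel d k x) [a] =
            gegenbauerEnd d k := by
          filter_upwards [ae_norm_eq_one_unifSpherePi hd1] with x hx
          rw [cycleProd, walkProd_nil, zonalKernel_self (hx a)]
        rw [integral_congr_ae h]
        simp
      rw [this, hL0]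
      simp only [List.toFinset_cons, List.toFinset_nil, insert_empty_eq, Finset.card_singleton]
      calc _ = 1 * |gegenbauerEnd d k| ^ (0 + 1 + 2) := by ring
        _ ≤ _ := by gcongr
    · obtain ⟨l', h1, h2, h3⟩ := exists_erase_loop hl hcs
      rw [Finset.insert_idem, Finset.insert_idem, ← List.toFinset_cons, ← List.toFinset_cons] at h2
      have hint : ∫ x, cycleProd (zonalKernel d k x) (a :: l) ∂(unifSpherePi d ι) =
          gegenbauerEnd d k *
            ∫ x, cycleProd (zonalKernel d k x) (a :: l') ∂(unifSpherePi d ι) := by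
        rw [← integral_const_mul]
        refine integral_congr_ae ?_
        filter_upwards [ae_norm_eq_one_unifSpherePi hd1] with x hx
        rw [cycleProd, h3, zonalKernel_self (hx c), cycleProd]
      simp only [List.length_cons] at hL hwp
      have := ih (a :: l') (by simp) (by simp; omega) (by simp; omega)
      rw [hint, abs_mul, ← h2, mul_assoc]
      calc _ ≤ |gegenbauerEnd d k| *
            (gegenbauerMoment d k (2 * p) * |gegenbauerEnd d k| ^ (L + 2)) := by gcongr
        _ = _ := by ring
  · push Not at hloop
    -- If every vertex recurs, then `2 V ≤ L`, so the moment bound is enough because `|E| ≥ 1`.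
    by_cases hcount : ∀ b ∈ a :: l, 2 ≤ (a :: l).count b
    · have hV := two_mul_card_toFinset_le hcount
      have := abs_integral_walkProd_le hd k a a l (by simpa using hwp) hloop
      simp only [cycleProd]
      gcongr
      omega
    · push Not at hcount
      obtain ⟨b, hb, hb1⟩ := hcount
      obtain ⟨l₁, l₂, hl⟩ := List.append_of_mem hb
      have hbl : b ∉ l₂ ++ l₁ := by
        rw [hl, List.count_append, List.count_cons_self] at hb1
        intro h
        have := List.count_pos_iff.2 h
        rw [List.count_append] at this
        omega
      -- Rotate the cycle so that the vertex visited once comes first.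
      have hrot : ∀ A : ι → ι → ℝ, cycleProd A (a :: l) = cycleProd A (b :: (l₂ ++ l₁)) := by
        intro A
        rw [hl, cycleProd_append_comm, List.cons_append]
      have hset : (a :: l).toFinset = insert b (l₂ ++ l₁).toFinset := by
        rw [hl]
        ext v
        simp
        tauto
      have hlen : (l₂ ++ l₁).length = L := by
        rw [hl] at hL
        simp at hL ⊢
        omega
      simp only [hrot]
      rw [hset, Finset.card_insert_of_notMem (by simpa using hbl)]
      rcases hcl : l₂ ++ l₁ with _ | ⟨c, t⟩
      · rw [hcl] at hrot hset hlen
        have hL0 : L = 0 := by simpa using hlen.symm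
        have hln : l = [] := by simpa [hL0] using hL
        subst hln
        exact absurd rfl (hloop (a, a) (by simp [walkSteps]))
      · rw [hcl] at hbl hlen
        have := ih (c :: t) (by simp) (by omega) hlen
        rw [integral_cycleProd_cons hd k hbl, abs_mul, abs_inv]
        calc _ = |gegenbauerEnd d k| * (|∫ x, cycleProd (zonalKernel d k x) (c :: t)
              ∂(unifSpherePi d ι)| * |gegenbauerEnd d k| ^ (2 * (c :: t).toFinset.card)) := by
              field_simp
              ring
          _ ≤ |gegenbauerEnd d k| *
              (gegenbauerMoment d k (2 * p) * |gegenbauerEnd d k| ^ (L + 2)) := by gcongr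
          _ = _ := by ring

end CycleBound

/-! ### Counting walks by their number of vertices. -/

section Counting

/-- The words of length `m` with distinct neighbours, weighted by `n ^ (-V)` where `V` is the
number of distinct letters, have total weight at most `(m - 1)!`. -/
lemma sum_inv_pow_card_toFinset_le {n : ℕ} (hn : 1 ≤ n) (m : ℕ) :
    ∑ f : Fin (m + 1) → Fin n, (if (List.ofFn f).IsChain (· ≠ ·) then
      ((n : ℝ) ^ (List.ofFn f).toFinset.card)⁻¹ else 0) ≤ m.factorial := by
  have hn0 : (0 : ℝ) < n := by exact_mod_cast hn
  induction m with
  | zero =>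
    refine (Finset.sum_le_sum (g := fun _ => (n : ℝ)⁻¹) fun f _ => ?_).trans_eq ?_
    · simp
    · simp [hn0.ne']
  | succ m ih =>
    rw [← (Fin.consEquiv fun _ : Fin (m + 2) => Fin n).sum_comp, Fintype.sum_prod_type,
      Finset.sum_comm]
    have key : ∀ f : Fin (m + 1) → Fin n,
        ∑ a : Fin n, (if (List.ofFn ((Fin.consEquiv fun _ : Fin (m + 2) => Fin n) (a, f))).IsChain
          (· ≠ ·) then ((n : ℝ) ^ (List.ofFn ((Fin.consEquiv fun _ : Fin (m + 2) => Fin n)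
            (a, f))).toFinset.card)⁻¹ else 0) ≤
        (m + 1) * (if (List.ofFn f).IsChain (· ≠ ·) then
          ((n : ℝ) ^ (List.ofFn f).toFinset.card)⁻¹ else 0) := by
      intro f
      have hcons : ∀ a : Fin n, List.ofFn ((Fin.consEquiv fun _ : Fin (m + 2) => Fin n) (a, f)) =
          a :: List.ofFn f := fun a => by
        simp [Fin.consEquiv, List.ofFn_succ]
      simp only [hcons]
      have hlen : (List.ofFn f).length = m + 1 := by simp
      generalize List.ofFn f = l at hlen ⊢
      obtain ⟨b, t, rfl⟩ := List.exists_cons_of_length_eq_add_one hlen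
      split_ifs with hc
      · set V := (b :: t).toFinset.card with hV
        have hVle : V ≤ m + 1 := (List.toFinset_card_le _).trans hlen.le
        have hb : b ∈ (b :: t).toFinset := by simp
        -- The new letter is one of the `V - 1` old ones other than `b`, or a fresh one at the extra
        -- cost `1/n`. The fresh ones together count as one more, for a total factor `V ≤ m + 1`.
        have hterm : ∀ a : Fin n, (if (a :: b :: t).IsChain (· ≠ ·) then
            ((n : ℝ) ^ (a :: b :: t).toFinset.card)⁻¹ else 0) ≤
            (if a ∈ (b :: t).toFinset.erase b then ((n : ℝ) ^ V)⁻¹ else 0) +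
              ((n : ℝ) ^ (V + 1))⁻¹ := by
          intro a
          rw [List.toFinset_cons]
          by_cases hab : a = b
          · rw [if_neg (by simp [hab]), if_neg (by simp [hab])]
            positivity
          · rw [if_pos (List.isChain_cons_cons.2 ⟨hab, hc⟩)]
            by_cases ha : a ∈ (b :: t).toFinset
            · rw [if_pos (Finset.mem_erase.2 ⟨hab, ha⟩), Finset.insert_eq_of_mem ha, ← hV]
              exact le_add_of_nonneg_right (by positivity)
            · rw [if_neg fun h => ha (Finset.mem_of_mem_erase h),
                Finset.card_insert_of_notMem ha, ← hV, zero_add]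
        refine (Finset.sum_le_sum fun a _ => hterm a).trans ?_
        rw [Finset.sum_add_distrib, Finset.sum_ite_mem, Finset.univ_inter, Finset.sum_const,
          Finset.card_erase_of_mem hb, ← hV, Finset.sum_const, Finset.card_univ, Fintype.card_fin,
          nsmul_eq_mul, nsmul_eq_mul, Nat.cast_sub (Finset.card_pos.2 ⟨b, hb⟩)]
        have e : (n : ℝ) * ((n : ℝ) ^ (V + 1))⁻¹ = ((n : ℝ) ^ V)⁻¹ := by
          rw [pow_succ]
          field_simp
        rw [e]
        calc ((V : ℝ) - (1 : ℕ)) * ((n : ℝ) ^ V)⁻¹ + ((n : ℝ) ^ V)⁻¹ =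
              V * ((n : ℝ) ^ V)⁻¹ := by push_cast; ring
          _ ≤ (m + 1) * ((n : ℝ) ^ V)⁻¹ := by
              gcongr
              exact_mod_cast hVle
      · rw [mul_zero]
        refine (Finset.sum_eq_zero fun a _ => if_neg fun h => hc ?_).le
        exact (List.isChain_cons_cons.1 h).2
    refine (Finset.sum_le_sum fun f _ => key f).trans ?_
    rw [← Finset.mul_sum, Nat.factorial_succ]
    push_cast
    gcongr

lemma factorial_two_mul_sub_one_le {p : ℕ} (hp : 1 ≤ p) :
    (2 * p - 1).factorial ≤ (2 * p) ^ (2 * p - 2) := by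
  obtain ⟨q, rfl⟩ := Nat.exists_eq_add_of_le hp
  rw [show 2 * (1 + q) - 1 = 2 * q + 1 by omega, show 2 * (1 + q) - 2 = 2 * q by omega]
  have h : ∀ m : ℕ, (m + 1).factorial ≤ (m + 1) ^ m := by
    intro m
    induction m with
    | zero => simp
    | succ m ih =>
      rw [Nat.factorial_succ, pow_succ, mul_comm]
      gcongr
      exact ih.trans (Nat.pow_le_pow_left (Nat.le_succ _) _)
  exact (h _).trans (Nat.pow_le_pow_left (by omega) _)

lemma matrix_pow_succ_apply {n : ℕ} (A : Matrix (Fin n) (Fin n) ℝ) (m : ℕ) (i j : Fin n) :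
    (A ^ (m + 1)) i j = ∑ f : Fin m → Fin n, walkProd (fun i j => A i j) i (List.ofFn f) j := by
  induction m generalizing i with
  | zero => simp [walkProd_nil]
  | succ m ih =>
    rw [pow_succ', Matrix.mul_apply, ← (Fin.consEquiv fun _ : Fin (m + 1) => Fin n).sum_comp,
      Fintype.sum_prod_type]
    refine Finset.sum_congr rfl fun a _ => ?_
    rw [ih, Finset.mul_sum]
    refine Finset.sum_congr rfl fun f _ => ?_
    have : List.ofFn ((Fin.consEquiv fun _ : Fin (m + 1) => Fin n) (a, f)) = a :: List.ofFn f := by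
      simp [Fin.consEquiv, List.ofFn_succ]
    rw [this, walkProd_cons]

lemma matrix_trace_pow_succ {n : ℕ} (A : Matrix (Fin n) (Fin n) ℝ) (m : ℕ) :
    (A ^ (m + 1)).trace =
      ∑ f : Fin (m + 1) → Fin n, cycleProd (fun i j => A i j) (List.ofFn f) := by
  rw [Matrix.trace, ← (Fin.consEquiv fun _ : Fin (m + 1) => Fin n).sum_comp, Fintype.sum_prod_type]
  refine Finset.sum_congr rfl fun a _ => ?_
  rw [Matrix.diag_apply, matrix_pow_succ_apply]
  refine Finset.sum_congr rfl fun f _ => ?_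
  simp [Fin.consEquiv, List.ofFn_succ, cycleProd]

lemma isChain_of_walkSteps {ι : Type*} {a j : ι} {l : List ι}
    (h : ∀ s ∈ walkSteps a l j, s.1 ≠ s.2) : (a :: l).IsChain (· ≠ ·) := by
  induction l generalizing a with
  | nil => simp
  | cons b t ih =>
    rw [walkSteps] at h
    exact List.isChain_cons_cons.2 ⟨h (a, b) (by simp),
      ih fun s hs => h s (List.mem_cons_of_mem _ hs)⟩

end Counting

/-! ### The trace moment under the product measure. -/

section TraceBound

variable {d n : ℕ}

/-- The zero diagonal kills every walk with a loop; the kernel itself does not vanish there. -/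
lemma walkProd_gegenbauerMatrix (k : ℕ) (x : Fin n → EuclideanSpace ℝ (Fin d)) (i j : Fin n)
    (l : List (Fin n)) : walkProd (fun i j => gegenbauerMatrix d k x i j) i l j =
      if ∀ s ∈ walkSteps i l j, s.1 ≠ s.2 then
        (1 / √(n : ℝ)) ^ (l.length + 1) * walkProd (zonalKernel d k x) i l j else 0 := by
  have hentry : ∀ i j : Fin n, gegenbauerMatrix d k x i j =
      if i = j then 0 else 1 / √(n : ℝ) * zonalKernel d k x i j := fun i j => rfl
  induction l generalizing i with
  | nil =>
    simp only [walkProd_nil, hentry, walkSteps, List.mem_singleton, forall_eq]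
    split_ifs <;> simp_all
  | cons a l ih =>
    rw [walkProd_cons, walkProd_cons, ih, hentry]
    simp only [walkSteps, List.forall_mem_cons, List.length_cons]
    split_ifs <;> first | (exfalso; tauto) | (simp only [mul_zero, zero_mul]) | skip
    ring

/-- The bound for a single closed walk, normalized by the number of walks of the same shape. -/
lemma cycle_weight_le (hn : 1 ≤ n) (hd : 2 ≤ d) (k : ℕ) {p : ℕ} (hp : 1 ≤ p) {a : Fin n}
    {l : List (Fin n)} (hl : (a :: l).length = 2 * p)
    (hne : ∀ s ∈ walkSteps a l a, s.1 ≠ s.2) :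
    (1 / √(n : ℝ)) ^ (2 * p) *
      |∫ x, cycleProd (zonalKernel d k x) (a :: l) ∂(unifSpherePi d (Fin n))| ≤
      ((n : ℝ) ^ (a :: l).toFinset.card)⁻¹ * (n * (∑ i ∈ Finset.range p,
        ((n : ℝ) / harmonicDim d k) ^ i) * gegenbauerMoment d k (2 * p)) := by
  have hn0 : (0 : ℝ) < n := by exact_mod_cast hn
  have hn1 : (1 : ℝ) ≤ n := by exact_mod_cast hn
  have hN := one_le_harmonicDim hd k
  have hN0 : 0 < harmonicDim d k := one_pos.trans_le hN
  have hM := one_le_gegenbauerMoment hd k p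
  have hM0 : 0 ≤ gegenbauerMoment d k (2 * p) := zero_le_one.trans hM
  have h1 := abs_integral_walkProd_le hd k a a l (p := p) (by simpa using hl.le) hne
  have h2 := abs_integral_cycleProd_mul_le hd k p (a :: l) (by simp) hl.le
  have hEsq : |gegenbauerEnd d k| ^ 2 = harmonicDim d k := by rw [sq_abs, gegenbauerEnd_sq hd]
  rw [hl, pow_mul, show 2 * p + 2 = 2 * (p + 1) by ring, pow_mul, hEsq] at h2
  have hsn : (1 / √(n : ℝ)) ^ (2 * p) = ((n : ℝ) ^ p)⁻¹ := by
    rw [pow_mul, div_pow, Real.sq_sqrt hn0.le, one_pow, one_div, inv_pow]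
  rw [hsn]
  set V := (a :: l).toFinset.card
  have hV : V ≤ 2 * p := (List.toFinset_card_le _).trans hl.le
  set E := |∫ x, cycleProd (zonalKernel d k x) (a :: l) ∂(unifSpherePi d (Fin n))| with hE
  set S := ∑ i ∈ Finset.range p, ((n : ℝ) / harmonicDim d k) ^ i
  have hS : ∀ i < p, ((n : ℝ) / harmonicDim d k) ^ i ≤ S := fun i hi =>
    Finset.single_le_sum (f := fun i => ((n : ℝ) / harmonicDim d k) ^ i)
      (fun j _ => by positivity) (Finset.mem_range.2 hi)
  have h1' : E ≤ gegenbauerMoment d k (2 * p) := h1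
  have hS1 : 1 ≤ S := by simpa using hS 0 hp
  have hE0 : 0 ≤ E := abs_nonneg _
  -- For `V ≤ p + 1` the moment bound suffices, and only the term `i = 0` of the geometric sum is
  -- used. Beyond that the exponent `V - p - 1 ≤ p - 1` selects a term of the sum.
  rcases le_or_gt V (p + 1) with hVp | hVp
  · have : ((n : ℝ) ^ p)⁻¹ ≤ ((n : ℝ) ^ V)⁻¹ * n := by
      rw [← div_eq_inv_mul, le_div_iff₀ (by positivity), ← div_eq_inv_mul,
        div_le_iff₀ (by positivity), ← pow_succ']
      exact pow_le_pow_right₀ hn1 hVp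
    calc ((n : ℝ) ^ p)⁻¹ * E ≤ (((n : ℝ) ^ V)⁻¹ * n) * gegenbauerMoment d k (2 * p) := by gcongr
      _ = ((n : ℝ) ^ V)⁻¹ * (n * 1 * gegenbauerMoment d k (2 * p)) := by ring
      _ ≤ _ := by gcongr
  · obtain ⟨i, hi⟩ := Nat.exists_eq_add_of_lt hVp
    have hVi : V = p + 1 + (i + 1) := by omega
    have hEN : E ≤ gegenbauerMoment d k (2 * p) / harmonicDim d k ^ (i + 1) := by
      rw [le_div_iff₀ (by positivity)]
      rw [hVi, pow_add, mul_left_comm, mul_comm] at h2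
      exact le_of_mul_le_mul_right h2 (by positivity)
    calc ((n : ℝ) ^ p)⁻¹ * E ≤
          ((n : ℝ) ^ p)⁻¹ * (gegenbauerMoment d k (2 * p) / harmonicDim d k ^ (i + 1)) := by gcongr
      _ = ((n : ℝ) ^ V)⁻¹ * (n * ((n : ℝ) / harmonicDim d k) ^ (i + 1) *
            gegenbauerMoment d k (2 * p)) := by
          rw [hVi, div_pow]
          field_simp
          ring
      _ ≤ _ := by
          have := hS (i + 1) (by omega)
          gcongr

lemma continuous_trace_gegenbauerMatrix_pow (k m : ℕ) :
    Continuous fun x : Fin n → EuclideanSpace ℝ (Fin d) =>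
      (gegenbauerMatrix d k x ^ m).trace := by
  have h : Continuous fun x : Fin n → EuclideanSpace ℝ (Fin d) => gegenbauerMatrix d k x := by
    refine continuous_matrix fun i j => ?_
    simp only [gegenbauerMatrix, Matrix.of_apply]
    split_ifs
    · exact continuous_const
    · exact continuous_const.mul (continuous_zonalKernel k i j)
  exact (h.pow m).matrix_trace

/-- The moment bound for the trace, with respect to the product of uniform measures. -/
lemma integral_trace_gegenbauerMatrix_pow_le (hd : 2 ≤ d) (hn : 1 ≤ n) (k : ℕ) {p : ℕ}
    (hp : 1 ≤ p) :
    ∫ x, ((gegenbauerMatrix d k x) ^ (2 * p)).trace ∂(unifSpherePi d (Fin n)) ≤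
      (2 * p - 1).factorial * (n * (∑ i ∈ Finset.range p, ((n : ℝ) / harmonicDim d k) ^ i) *
        gegenbauerMoment d k (2 * p)) := by
  have hd1 : 1 ≤ d := one_le_two.trans hd
  have hN0 : 0 < harmonicDim d k := one_pos.trans_le (one_le_harmonicDim hd k)
  have hM0 : 0 ≤ gegenbauerMoment d k (2 * p) :=
    zero_le_one.trans (one_le_gegenbauerMoment hd k p)
  set B := n * (∑ i ∈ Finset.range p, ((n : ℝ) / harmonicDim d k) ^ i) *
    gegenbauerMoment d k (2 * p)
  have hB : 0 ≤ B := by positivity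
  obtain ⟨m, hm⟩ : ∃ m, 2 * p = m + 1 := ⟨2 * p - 1, by omega⟩
  have hcont : ∀ l : List (Fin n), Continuous fun x : Fin n → EuclideanSpace ℝ (Fin d) =>
      cycleProd (zonalKernel d k x) l := fun l =>
    continuous_cycleProd (fun a b => continuous_zonalKernel k a b) l
  have hrw : ∀ (f : Fin (m + 1) → Fin n) (x : Fin n → EuclideanSpace ℝ (Fin d)),
      cycleProd (fun i j => gegenbauerMatrix d k x i j) (List.ofFn f) =
      if ∀ s ∈ walkSteps (f 0) (List.ofFn fun i => f (Fin.succ i)) (f 0), s.1 ≠ s.2 then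
        (1 / √(n : ℝ)) ^ (m + 1) * cycleProd (zonalKernel d k x) (List.ofFn f) else 0 := by
    intro f x
    rw [List.ofFn_succ, cycleProd, walkProd_gegenbauerMatrix, List.length_ofFn]
    rfl
  have hterm : ∀ f : Fin (m + 1) → Fin n,
      ∫ x, cycleProd (fun i j => gegenbauerMatrix d k x i j) (List.ofFn f)
        ∂(unifSpherePi d (Fin n)) ≤
      (if (List.ofFn f).IsChain (· ≠ ·) then
        ((n : ℝ) ^ (List.ofFn f).toFinset.card)⁻¹ else 0) * B := by
    intro f
    simp only [hrw]
    split_ifs with h1 h2 h2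
    · rw [integral_const_mul]
      refine (mul_le_mul_of_nonneg_left (le_abs_self _) (by positivity)).trans ?_
      rw [List.ofFn_succ]
      have := cycle_weight_le hn hd k hp (by simp [hm]) h1
      simpa only [B, hm] using this
    · rw [List.ofFn_succ] at h2
      exact absurd (isChain_of_walkSteps h1) h2
    · simp only [integral_zero]
      positivity
    · simp
  rw [hm]
  simp only [matrix_trace_pow_succ]
  rw [integral_finsetSum]
  · refine (Finset.sum_le_sum fun f _ => hterm f).trans ?_
    rw [← Finset.sum_mul, Nat.add_sub_cancel]
    exact mul_le_mul_of_nonneg_right (sum_inv_pow_card_toFinset_le hn m) hB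
  · intro f _
    simp only [hrw]
    split_ifs
    · exact (integrable_unifSpherePi hd1 (hcont _)).const_mul _
    · exact integrable_zero _ _ _

end TraceBound

/-! ### Transfer to arbitrary probability spaces. -/

section RandomPoints

variable {d n : ℕ} {Ω : Type*} [MeasurableSpace Ω] {P : Measure Ω} [IsProbabilityMeasure P]
  {x : Fin n → Ω → EuclideanSpace ℝ (Fin d)}

lemma IsIIDUnifSphere.measurePreserving (h : IsIIDUnifSphere P d n x) :
    MeasurePreserving (fun ω i => x i ω) P (unifSpherePi d (Fin n)) := by
  refine ⟨measurable_pi_lambda _ h.measurable, ?_⟩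
  rw [(iIndepFun_iff_map_fun_eq_pi_map fun i => (h.measurable i).aemeasurable).1 h.indep,
    unifSpherePi]
  simp only [h.law]

lemma integrable_trace_gegenbauerMatrix_pow (hd : 2 ≤ d) (h : IsIIDUnifSphere P d n x) (k m : ℕ) :
    Integrable (fun ω => ((gegenbauerMatrix d k (fun i => x i ω)) ^ m).trace) P :=
  h.measurePreserving.integrable_comp_of_integrable
    (integrable_unifSpherePi (one_le_two.trans hd) (continuous_trace_gegenbauerMatrix_pow k m))

lemma integral_trace_gegenbauerMatrix_pow_le_factorial (hd : 2 ≤ d) (hn : 1 ≤ n)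
    (h : IsIIDUnifSphere P d n x) (k : ℕ) {p : ℕ} (hp : 1 ≤ p) :
    ∫ ω, ((gegenbauerMatrix d k (fun i => x i ω)) ^ (2 * p)).trace ∂P ≤
      (2 * p - 1).factorial * (n * (∑ i ∈ Finset.range p, ((n : ℝ) / harmonicDim d k) ^ i) *
        gegenbauerMoment d k (2 * p)) := by
  refine le_of_eq_of_le ?_ (integral_trace_gegenbauerMatrix_pow_le hd hn k hp)
  rw [← h.measurePreserving.map_eq, integral_map h.measurePreserving.measurable.aemeasurable
    (continuous_trace_gegenbauerMatrix_pow k (2 * p)).aestronglyMeasurable]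

end RandomPoints

/-! ### From trace moments to the operator norm. -/

section OperatorNorm

lemma opNorm_sq_le_sum_sq {n : ℕ} (B : Matrix (Fin n) (Fin n) ℝ) :
    opNorm B ^ 2 ≤ ∑ i, ∑ j, B i j ^ 2 := by
  have h0 : 0 ≤ ∑ i, ∑ j, B i j ^ 2 :=
    Finset.sum_nonneg fun i _ => Finset.sum_nonneg fun j _ => sq_nonneg _
  suffices h : opNorm B ≤ √(∑ i, ∑ j, B i j ^ 2) by
    have := pow_le_pow_left₀ (norm_nonneg _) h 2
    rwa [Real.sq_sqrt h0] at this
  refine ContinuousLinearMap.opNorm_le_bound _ (Real.sqrt_nonneg _) fun v => ?_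
  rw [← sq_le_sq₀ (norm_nonneg _) (by positivity), mul_pow, Real.sq_sqrt h0,
    EuclideanSpace.real_norm_sq_eq, EuclideanSpace.real_norm_sq_eq, Finset.sum_mul]
  refine Finset.sum_le_sum fun i _ => ?_
  simpa [Matrix.mulVec, dotProduct] using
    Finset.sum_mul_sq_le_sq_mul_sq Finset.univ (fun j => B i j) fun j => v j

/-- Powers of two arise from iterating the C⋆-identity, `‖A ^ 2 ^ m‖ = ‖A‖ ^ 2 ^ m`; the last square
is the Frobenius bound. -/
lemma opNorm_pow_le_trace {n : ℕ} {A : Matrix (Fin n) (Fin n) ℝ} (hA : A.IsSymm) (m : ℕ) :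
    opNorm A ^ (2 * 2 ^ m) ≤ (A ^ (2 * 2 ^ m)).trace := by
  have hsa : IsSelfAdjoint (Matrix.toEuclideanCLM (n := Fin n) (𝕜 := ℝ) A) := by
    have : IsSelfAdjoint A := by
      rw [IsSelfAdjoint, Matrix.star_eq_conjTranspose, Matrix.conjTranspose_eq_transpose_of_trivial]
      exact hA
    exact this.map _
  have h1 : opNorm (A ^ 2 ^ m) = opNorm A ^ 2 ^ m := by
    rw [opNorm, opNorm, map_pow, hsa.norm_pow_two_pow]
  have h2 := opNorm_sq_le_sum_sq (A ^ 2 ^ m)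
  rw [mul_comm, pow_mul, ← h1, pow_mul]
  refine h2.trans_eq ?_
  have hs : (A ^ 2 ^ m).IsSymm := hA.pow _
  rw [sq (A ^ 2 ^ m), Matrix.trace]
  refine Finset.sum_congr rfl fun i _ => ?_
  rw [Matrix.diag_apply, Matrix.mul_apply]
  refine Finset.sum_congr rfl fun j _ => ?_
  rw [sq, hs.apply i j]

lemma isSymm_gegenbauerMatrix {d n : ℕ} (k : ℕ) (x : Fin n → EuclideanSpace ℝ (Fin d)) :
    (gegenbauerMatrix d k x).IsSymm := by
  refine Matrix.IsSymm.ext fun i j => ?_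
  simp only [gegenbauerMatrix, Matrix.of_apply, eq_comm (a := j), real_inner_comm (x i)]

lemma measure_opNorm_gt_le {d n : ℕ} {Ω : Type*} [MeasurableSpace Ω] {P : Measure Ω}
    [IsProbabilityMeasure P] {x : Fin n → Ω → EuclideanSpace ℝ (Fin d)} (hd : 2 ≤ d)
    (h : IsIIDUnifSphere P d n x) (k m : ℕ) {t : ℝ} (ht : 0 < t) :
    P {ω | opNorm (gegenbauerMatrix d k (fun i => x i ω)) > t} ≤
      ENNReal.ofReal ((∫ ω, ((gegenbauerMatrix d k (fun i => x i ω)) ^ (2 * 2 ^ m)).trace ∂P) /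
        t ^ (2 * 2 ^ m)) := by
  have hnn : ∀ ω, opNorm (gegenbauerMatrix d k (fun i => x i ω)) ^ (2 * 2 ^ m) ≤
      ((gegenbauerMatrix d k (fun i => x i ω)) ^ (2 * 2 ^ m)).trace :=
    fun ω => opNorm_pow_le_trace (isSymm_gegenbauerMatrix _ _) m
  have htp : 0 < t ^ (2 * 2 ^ m) := pow_pos ht _
  have hmarkov := mul_meas_ge_le_integral_of_nonneg (μ := P)
    (f := fun ω => ((gegenbauerMatrix d k (fun i => x i ω)) ^ (2 * 2 ^ m)).trace)
    (Eventually.of_forall fun ω => (pow_nonneg (norm_nonneg _) _).trans (hnn ω))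
    (integrable_trace_gegenbauerMatrix_pow hd h k _) (t ^ (2 * 2 ^ m))
  calc P {ω | opNorm (gegenbauerMatrix d k (fun i => x i ω)) > t}
      ≤ P {ω | t ^ (2 * 2 ^ m) ≤
          ((gegenbauerMatrix d k (fun i => x i ω)) ^ (2 * 2 ^ m)).trace} :=
        measure_mono fun ω hω => (pow_le_pow_left₀ ht.le (le_of_lt hω) _).trans (hnn ω)
    _ = ENNReal.ofReal (P.real {ω | t ^ (2 * 2 ^ m) ≤
          ((gegenbauerMatrix d k (fun i => x i ω)) ^ (2 * 2 ^ m)).trace}) := by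
        rw [measureReal_def, ENNReal.ofReal_toReal (measure_ne_top _ _)]
    _ ≤ _ := by
        refine ENNReal.ofReal_le_ofReal ?_
        rw [le_div_iff₀ htp, mul_comm]
        exact hmarkov

/-- The moment bound for the trace in the polynomial scaling `n ≤ C d ^ ℓ`. -/
lemma exists_trace_bound (k ℓ p : ℕ) (hp : 1 ≤ p) (C₀ : ℝ) :
    ∃ C : ℝ, ∀ (d n : ℕ), 2 ≤ d → 1 ≤ n → (n : ℝ) ≤ C₀ * (d : ℝ) ^ ℓ →
      (2 * p - 1).factorial * (n * (∑ i ∈ Finset.range p, ((n : ℝ) / harmonicDim d k) ^ i) *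
        gegenbauerMoment d k (2 * p)) ≤ C * (d : ℝ) ^ ((ℓ : ℝ) + max ((ℓ : ℝ) - k) 0 * p) := by
  obtain ⟨c, hc, hcN⟩ := exists_le_harmonicDim k
  obtain ⟨M, hM⟩ := exists_gegenbauer_moment_le k p
  set e : ℝ := max ((ℓ : ℝ) - k) 0 with he
  have he0 : 0 ≤ e := le_max_right _ _
  refine ⟨(2 * p - 1).factorial * (C₀ * (p * (max (C₀ / c) 1) ^ p) * M), fun d n hd hn hnd => ?_⟩
  have hd1 : (1 : ℝ) ≤ d := by exact_mod_cast one_le_two.trans hd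
  have hd0 : (0 : ℝ) < d := one_pos.trans_le hd1
  have hn0 : (0 : ℝ) < n := by exact_mod_cast hn
  have hN0 : 0 < harmonicDim d k := one_pos.trans_le (one_le_harmonicDim hd k)
  have hM0 : 0 ≤ gegenbauerMoment d k (2 * p) :=
    zero_le_one.trans (one_le_gegenbauerMoment hd k p)
  have hMle : gegenbauerMoment d k (2 * p) ≤ M := hM d hd
  have hC₀ : 0 < C₀ := by
    by_contra hneg
    push Not at hneg
    have : C₀ * (d : ℝ) ^ ℓ ≤ 0 := mul_nonpos_of_nonpos_of_nonneg hneg (by positivity)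
    linarith
  have hde : 1 ≤ (d : ℝ) ^ e := Real.one_le_rpow hd1 he0
  have hratio : (n : ℝ) / harmonicDim d k ≤ max (C₀ / c) 1 * (d : ℝ) ^ e := by
    calc (n : ℝ) / harmonicDim d k ≤ (C₀ * (d : ℝ) ^ ℓ) / (c * (d : ℝ) ^ k) := by
          have := hcN d hd
          gcongr
      _ = (C₀ / c) * (d : ℝ) ^ ((ℓ : ℝ) - k) := by
          rw [Real.rpow_sub hd0, Real.rpow_natCast, Real.rpow_natCast]
          field_simp
      _ ≤ max (C₀ / c) 1 * (d : ℝ) ^ e :=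
          mul_le_mul (le_max_left _ _) (Real.rpow_le_rpow_of_exponent_le hd1 (le_max_left _ _))
            (by positivity) (by positivity)
  have hsum : ∑ i ∈ Finset.range p, ((n : ℝ) / harmonicDim d k) ^ i ≤
      p * (max (C₀ / c) 1) ^ p * (d : ℝ) ^ (e * p) := by
    calc ∑ i ∈ Finset.range p, ((n : ℝ) / harmonicDim d k) ^ i
        ≤ ∑ _i ∈ Finset.range p, (max (C₀ / c) 1 * (d : ℝ) ^ e) ^ p := by
          refine Finset.sum_le_sum fun i hi => ?_
          refine (pow_le_pow_left₀ (by positivity) hratio i).trans ?_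
          exact pow_le_pow_right₀ (one_le_mul_of_one_le_of_one_le (le_max_right _ _) hde)
            (Finset.mem_range.1 hi).le
      _ = p * (max (C₀ / c) 1) ^ p * (d : ℝ) ^ (e * p) := by
          rw [Finset.sum_const, Finset.card_range, nsmul_eq_mul, mul_pow, Real.rpow_mul hd0.le,
            Real.rpow_natCast]
          ring
  calc _ ≤ (2 * p - 1).factorial * ((C₀ * (d : ℝ) ^ ℓ) *
        (p * (max (C₀ / c) 1) ^ p * (d : ℝ) ^ (e * p)) * M) := by gcongr
    _ = _ := by
        rw [Real.rpow_add hd0, Real.rpow_natCast]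
        ring

lemma eventually_le_of_isBigO {α : ℝ} {ℓ : ℕ} {n : ℕ → ℕ} (hα : 0 < α)
    (h : (fun d : ℕ => (n d : ℝ) / (d : ℝ) ^ ℓ - α) =O[atTop]
      (fun d : ℕ => (d : ℝ) ^ (-(1 / 2) : ℝ))) :
    ∀ᶠ d : ℕ in atTop, 1 ≤ n d ∧ (n d : ℝ) ≤ (α + 1) * (d : ℝ) ^ ℓ := by
  have h0 : Tendsto (fun d : ℕ => (d : ℝ) ^ (-(1 / 2) : ℝ)) atTop (nhds 0) :=
    (tendsto_rpow_neg_atTop (by norm_num : (0 : ℝ) < 1 / 2)).comp tendsto_natCast_atTop_atTop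
  have h1 := h.trans_tendsto h0
  filter_upwards [h1.eventually (lt_mem_nhds (neg_lt_zero.2 hα)),
    h1.eventually (gt_mem_nhds one_pos), eventually_ge_atTop 1] with d hd1 hd2 hd3
  have hd0 : (0 : ℝ) < (d : ℝ) ^ ℓ := by positivity
  constructor
  · rw [Nat.one_le_iff_ne_zero]
    intro hn
    rw [hn] at hd1
    simp at hd1
  · have : (n d : ℝ) / (d : ℝ) ^ ℓ ≤ α + 1 := by linarith
    rwa [div_le_iff₀ hd0] at this

lemma stochDom_opNorm_gegenbauerMatrix (k : ℕ) {α : ℝ} {ℓ : ℕ} {n : ℕ → ℕ} (hα : 0 < α)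
    (hn : (fun d : ℕ => (n d : ℝ) / (d : ℝ) ^ ℓ - α) =O[atTop]
      (fun d : ℕ => (d : ℝ) ^ (-(1 / 2) : ℝ)))
    {Ω : ℕ → Type*} [∀ d, MeasurableSpace (Ω d)] (P : ∀ d, Measure (Ω d))
    [∀ d, IsProbabilityMeasure (P d)] (x : ∀ d, Fin (n d) → Ω d → EuclideanSpace ℝ (Fin d))
    (hx : ∀ d, 1 ≤ d → IsIIDUnifSphere (P d) d (n d) (x d)) :
    StochDom P (U := fun _ => Unit)
      (fun d _ ω => opNorm (gegenbauerMatrix d k (fun i => x d i ω)))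
      (fun d _ _ => (d : ℝ) ^ (max ((ℓ : ℝ) - k) 0 / 2)) := by
  intro ε hε D hD
  set e : ℝ := max ((ℓ : ℝ) - k) 0 with he
  -- With `p = 2 ^ m`, the gain `d ^ (2εp)` has to beat `d ^ ℓ` from the factor `n`, the target `d ^
  -- D`, and one more `d` absorbing the constant `C`. The powers `d ^ (e p)` cancel.
  obtain ⟨m, hm⟩ : ∃ m : ℕ, (ℓ + D + 1) / (2 * ε) < (2 : ℝ) ^ m :=
    pow_unbounded_of_one_lt _ one_lt_two
  have hm' : ℓ + D + 1 < 2 * ε * 2 ^ m := by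
    rw [div_lt_iff₀ (by positivity)] at hm
    linarith
  obtain ⟨C, hC⟩ := exists_trace_bound k ℓ (2 ^ m) Nat.one_le_two_pow (α + 1)
  filter_upwards [eventually_le_of_isBigO hα hn, eventually_ge_atTop 2,
    tendsto_natCast_atTop_atTop.eventually_ge_atTop C] with d ⟨hnd1, hnd2⟩ hd hdC
  have hd1 : (1 : ℝ) ≤ d := by exact_mod_cast one_le_two.trans hd
  have hd0 : (0 : ℝ) < d := one_pos.trans_le hd1
  refine iSup_le fun _ => ?_
  have ht : 0 < (d : ℝ) ^ ε * (d : ℝ) ^ (e / 2) := by positivity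
  refine (measure_opNorm_gt_le hd (hx d (one_le_two.trans hd)) k m ht).trans
    (ENNReal.ofReal_le_ofReal ?_)
  have hE := (integral_trace_gegenbauerMatrix_pow_le_factorial hd hnd1
    (hx d (one_le_two.trans hd)) k (Nat.one_le_two_pow (n := m))).trans (hC d (n d) hd hnd1 hnd2)
  have htp : ((d : ℝ) ^ ε * (d : ℝ) ^ (e / 2)) ^ (2 * 2 ^ m) =
      (d : ℝ) ^ (2 * ε * 2 ^ m + e * (2 ^ m : ℕ)) := by
    rw [← Real.rpow_add hd0, ← Real.rpow_natCast, ← Real.rpow_mul hd0.le]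
    congr 1
    push_cast
    ring
  rw [div_le_iff₀ (pow_pos ht _), htp]
  refine hE.trans ?_
  calc C * (d : ℝ) ^ ((ℓ : ℝ) + e * (2 ^ m : ℕ))
      ≤ (d : ℝ) ^ (1 : ℝ) * (d : ℝ) ^ ((ℓ : ℝ) + e * (2 ^ m : ℕ)) := by
        rw [Real.rpow_one]
        gcongr
    _ = (d : ℝ) ^ (1 + ((ℓ : ℝ) + e * (2 ^ m : ℕ))) := by rw [← Real.rpow_add hd0]
    _ ≤ (d : ℝ) ^ (-D + (2 * ε * 2 ^ m + e * (2 ^ m : ℕ))) :=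
        Real.rpow_le_rpow_of_exponent_le hd1 (by linarith)
    _ = (d : ℝ) ^ (-D) * (d : ℝ) ^ (2 * ε * 2 ^ m + e * (2 ^ m : ℕ)) := Real.rpow_add hd0 _ _

end OperatorNorm

theorem mainTheorem3 (k : ℕ) :
    -- improved trace moment bound
    (∀ (d n p : ℕ), 2 ≤ d → 1 ≤ n → 1 ≤ p →
      ∀ (Ω : Type*) [MeasurableSpace Ω] (P : Measure Ω) [IsProbabilityMeasure P]
        (x : Fin n → Ω → EuclideanSpace ℝ (Fin d)), IsIIDUnifSphere P d n x →
        Integrable (fun ω => ((gegenbauerMatrix d k (fun i => x i ω)) ^ (2 * p)).trace) P ∧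
        ∫ ω, ((gegenbauerMatrix d k (fun i => x i ω)) ^ (2 * p)).trace ∂P ≤
          (n : ℝ) * (2 * (p : ℝ)) ^ (2 * p - 2) *
            ((p : ℝ) / n + ∑ i ∈ Finset.range p, ((n : ℝ) / harmonicDim d k) ^ i) *
            ∫ t, ((gegenbauer d k).eval t) ^ (2 * p) ∂(sphereLaw d)) ∧
    -- operator norm bounds
    (∀ (α : ℝ) (ℓ : ℕ) (n : ℕ → ℕ), 0 < α → 1 ≤ ℓ →
      (fun d : ℕ => (n d : ℝ) / (d : ℝ) ^ ℓ - α) =O[atTop]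
        (fun d : ℕ => (d : ℝ) ^ (-(1 / 2) : ℝ)) →
      ∀ (Ω : ℕ → Type*) [∀ d, MeasurableSpace (Ω d)] (P : ∀ d, Measure (Ω d))
        [∀ d, IsProbabilityMeasure (P d)]
        (x : ∀ d, Fin (n d) → Ω d → EuclideanSpace ℝ (Fin d)),
        (∀ d, 1 ≤ d → IsIIDUnifSphere (P d) d (n d) (x d)) →
        StochDom P (U := fun _ => Unit)
            (fun d _ ω => opNorm (gegenbauerMatrix d k (fun i => x d i ω)))
            (fun d _ _ => (d : ℝ) ^ (max ((ℓ : ℝ) - k) 0 / 2)) ∧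
        (ℓ ≤ k → StochDom P (U := fun _ => Unit)
            (fun d _ ω => opNorm (gegenbauerMatrix d k (fun i => x d i ω)))
            (fun _ _ _ => 1))) := by

  refine ⟨?_, ?_⟩
  · intro d n p hd hn hp Ω _ P _ x hx
    refine ⟨integrable_trace_gegenbauerMatrix_pow hd hx k _, ?_⟩
    refine (integral_trace_gegenbauerMatrix_pow_le_factorial hd hn hx k hp).trans ?_
    have hN0 : 0 < harmonicDim d k := one_pos.trans_le (one_le_harmonicDim hd k)
    have hM0 : 0 ≤ gegenbauerMoment d k (2 * p) :=
      zero_le_one.trans (one_le_gegenbauerMoment hd k p)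
    have hfac : ((2 * p - 1).factorial : ℝ) ≤ (2 * (p : ℝ)) ^ (2 * p - 2) := by
      exact_mod_cast factorial_two_mul_sub_one_le hp
    set S := ∑ i ∈ Finset.range p, ((n : ℝ) / harmonicDim d k) ^ i
    have hS : 0 ≤ S := Finset.sum_nonneg fun i _ => by positivity
    have hpn : (0 : ℝ) ≤ (p : ℝ) / n := by positivity
    -- The bound with the factorial is the stronger one; the term `p / n` is added only as a
    -- nonnegative quantity.
    calc ((2 * p - 1).factorial : ℝ) * (n * S * gegenbauerMoment d k (2 * p))
        ≤ (2 * (p : ℝ)) ^ (2 * p - 2) *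
          (n * ((p : ℝ) / n + S) * gegenbauerMoment d k (2 * p)) := by
          gcongr
          linarith
      _ = (n : ℝ) * (2 * (p : ℝ)) ^ (2 * p - 2) * ((p : ℝ) / n + S) *
          gegenbauerMoment d k (2 * p) := by ring
  · intro α ℓ n hα _ hn Ω _ P _ x hx
    have h := stochDom_opNorm_gegenbauerMatrix k hα hn P x hx
    refine ⟨h, fun hℓk => ?_⟩
    have : max ((ℓ : ℝ) - k) 0 = 0 := max_eq_right (by
      rw [sub_nonpos]
      exact_mod_cast hℓk)
    simpa only [this, zero_div, Real.rpow_zero] using h
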